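/- Let $X\subset\mathbb R^d$, let $k$ be a (measurable) positive semidefinite kernel on $X$ with $k(x,x)\le 1$ for all $x$, and let $H_k$ be its reproducing kernel Hilbert space. Let $f\in H_k$ with $\|f\|_k\le B$, let $\delta\in(0,1)$ and $\lambda>0$, and let the observations be $y_t=f(x_t)+\epsilon_t$, where $x_t$ is $\mathcal F_{t-1}$-measurable, $\epsilon_t$ is $\mathcal F_t$-measurable, and the noise is conditionally $R$-sub-Gaussian for some $R\ge 0$: $\mathbb E[e^{s\epsilon_t}\mid\mathcal F_{t-1}]\le e^{s^2R^2/2}$ for all $s\in\mathbb R$. After $t$ observations write $K_t=[k(x_i,x_j)]_{i,j\le t}$, $k_t(x)=[k(x,x_i)]_{i\le t}$, and $$\mu_t(x)=k_t(x)^T(K_t+\lambda I)^{-1}y_{1:t},\qquad \sigma_t^2(x)=k(x,x)-k_t(x)^T(K_t+\lambda I)^{-1}k_t(x).$$ Let $\gamma_t$ be the maximum information gain: the supremum, over all choices $A$ of $t$ points of $X$ (repetitions allowed), of the mutual information $I(y_A;f_A)$, where $f_A$ is the vector of values at $A$ of a centred Gaussian process with covariance $k$ and $y_A=f_A+\epsilon_A$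 with $\epsilon_A\sim\mathcal N(0,\lambda I)$ independent of $f_A$. The GP-EI algorithm chooses, in the rounds $t=1,\dots,T$, $$x_t\in\operatorname{argmax}_{x\in X}\ \rho\big(\mu_{t-1}(x)-\mu_t^+,\ \omega_t\sigma_{t-1}(x)\big),\qquad \omega_t=\sqrt{\gamma_{t-1}+1+\ln(1/\delta)},$$ where $\mu_t^+=\max_{i\le t-1}\mu_{t-1}(x_i)$ (and $\mu_1^+=0$), $\rho(u,v)=u\Phi(u/v)+v\phi(u/v)$ for $v>0$ and $\rho(u,0)=\max\{0,u\}$, with $\Phi,\phi$ the standard normal distribution function and density. In round $t$ it reports $x_t^+\in\operatorname{argmax}\{\mu_{t-1}(x_i): 1\le i\le t\}$. Let $R_n=\sum_{t=1}^n\big(\sup_{x\in X} f(x)-f(x_t^+)\big)$ and $\beta_n=B+R\sqrt{2(\gamma_{n-1}+1+\ln(1/\delta))}$. Fix $0<\lambda_0\le\lambda_1$ and consider any $\lambda\in[\lambda_0,\lambda_1]$, which may depend on the horizon $T$ (for instance $\lambda=1+2/T$). 1. There is a constant $C$, depending only on $B,R,\delta,\lambda_0,\lambda_1$ and the kernel $k$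 (with its domain $X$), such that for every horizon $T$, with probability at least $1-\delta$, $R_n\le C\,\gamma_n\sqrt n$ for all $1\le n\le T$; in particular $R_T=O(\gamma_T\sqrt T)$. 2. If $R>0$, there is a constant $C$, depending only on $B,R,\lambda_0,\lambda_1$, such that for every horizon $T$, with probability at least $1-\delta$, $R_n\le C\,\beta_n\sqrt{n\gamma_n}$ for all $1\le n\le T$; in particular $R_T=O(\beta_T\sqrt{T\gamma_T})$. -/

import Mathlib

open MeasureTheory ProbabilityTheory

noncomputable section

namespace GPEI

/-- The real-valued reproducing kernel `k(x, z)` of a reproducing kernel Hilbert space `H` of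
real functions on `X` (Mathlib's kernel takes values in `ℝ →L[ℝ] ℝ`). -/
def rkhsKernel (H : Type*) {X : Type*} [NormedAddCommGroup H] [InnerProductSpace ℝ H]
    [CompleteSpace H] [RKHS ℝ H X ℝ] (x z : X) : ℝ :=
  RKHS.kernel H x z 1

section GaussianProcess

variable {X : Type*}

/-- Kernel matrix `K = [k(xᵢ, xⱼ)]` of a tuple of points. -/
def kernelMatrix (k : X → X → ℝ) {t : ℕ} (x : Fin t → X) : Matrix (Fin t) (Fin t) ℝ :=
  Matrix.of fun i j => k (x i) (x j)

/-- Kernel vector `[k(z, x₁), …, k(z, x_t)]`. -/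
def kernelVec (k : X → X → ℝ) {t : ℕ} (x : Fin t → X) (z : X) : Fin t → ℝ :=
  fun i => k z (x i)

/-- Posterior mean `k_t(z)ᵀ (K_t + λ I)⁻¹ y` after the observations `y` at the points `x`. -/
def postMean (k : X → X → ℝ) (lam : ℝ) {t : ℕ} (x : Fin t → X) (y : Fin t → ℝ) (z : X) : ℝ :=
  kernelVec k x z ⬝ᵥ
    Matrix.mulVec (kernelMatrix k x + lam • (1 : Matrix (Fin t) (Fin t) ℝ))⁻¹ y

/-- Posterior variance `k(z, z) - k_t(z)ᵀ (K_t + λ I)⁻¹ k_t(z)`. -/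
def postVar (k : X → X → ℝ) (lam : ℝ) {t : ℕ} (x : Fin t → X) (z : X) : ℝ :=
  k z z - kernelVec k x z ⬝ᵥ
    Matrix.mulVec (kernelMatrix k x + lam • (1 : Matrix (Fin t) (Fin t) ℝ))⁻¹ (kernelVec k x z)

/-- Posterior standard deviation. -/
def postStd (k : X → X → ℝ) (lam : ℝ) {t : ℕ} (x : Fin t → X) (z : X) : ℝ :=
  Real.sqrt (postVar k lam x z)

/-- Incumbent: the largest value of the posterior mean over the points sampled so far.  Before
any point has been sampled the posterior mean is the prior mean `0`, and so is the incumbent. -/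
def incumbent (k : X → X → ℝ) (lam : ℝ) :
    {t : ℕ} → (Fin t → X) → (Fin t → ℝ) → ℝ
  | 0, _, _ => 0
  | _ + 1, x, y => Finset.univ.sup' Finset.univ_nonempty fun i => postMean k lam x y (x i)

end GaussianProcess

/-- `ρ(u, v) = u Φ(u / v) + v φ(u / v)` if `v > 0` and `max {0, u}` otherwise, where `Φ` and `φ`
are the distribution function and the density of the standard normal law. -/
def rho (u v : ℝ) : ℝ :=
  if 0 < v then
    u * cdf (gaussianReal 0 1) (u / v) + v * gaussianPDFReal 0 1 (u / v)
  else max 0 u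

/-- Mutual information of the two components of a pair with law `P`: the Kullback-Leibler
divergence of the joint law from the product of the marginal laws. -/
def mutualInfo {α β : Type*} [MeasurableSpace α] [MeasurableSpace β] (P : Measure (α × β)) :
    ENNReal :=
  InformationTheory.klDiv P (P.fst.prod P.snd)

/-- Joint law of `(f_A, y_A)`, where `f_A` is the vector of the values at the points `A` of a
centred Gaussian process with covariance `k`, and `y_A = f_A + ε_A` with `ε_A ∼ N(0, λ I)`
independent of `f_A`. -/
def obsLaw {X : Type*} (k : X → X → ℝ) (lam : ℝ) {t : ℕ} (A : Fin t → X) :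
    Measure (EuclideanSpace ℝ (Fin t) × EuclideanSpace ℝ (Fin t)) :=
  ((multivariateGaussian 0 (kernelMatrix k A)).prod
    (multivariateGaussian 0 (lam • (1 : Matrix (Fin t) (Fin t) ℝ)))).map
    fun p => (p.1, p.1 + p.2)

/-- Maximum information gain `γ_t`: the supremum of `I(y_A; f_A)` over all choices `A` of `t`
points of `X`, with repetitions allowed. -/
def maxInfoGain {X : Type*} (k : X → X → ℝ) (lam : ℝ) (t : ℕ) : ℝ :=
  (⨆ A : Fin t → X, mutualInfo (obsLaw k lam A)).toReal

/-- `√(γ_t + 1 + ln (1 / δ))`, the exploration scale of the round that follows `t` observations. -/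
def scale {X : Type*} (k : X → X → ℝ) (lam δ : ℝ) (t : ℕ) : ℝ :=
  Real.sqrt (maxInfoGain (X := X) k lam t + 1 + Real.log (1 / δ))

/-- `β_n = B + R √(2 (γ_{n-1} + 1 + ln (1 / δ)))`, for `n ≥ 1`. -/
def beta {X : Type*} (k : X → X → ℝ) (lam δ B R : ℝ) (n : ℕ) : ℝ :=
  B + R * Real.sqrt (2 * (maxInfoGain (X := X) k lam (n - 1) + 1 + Real.log (1 / δ)))

section Runs

variable {Ω X : Type*}

/-- The points of the first `t` rounds. Rounds are numbered from `0`: `x s` and `ε s` belong to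
the `(s + 1)`-st round. -/
def pts (x : ℕ → Ω → X) (t : ℕ) (w : Ω) : Fin t → X := fun i => x i w

/-- The observations `y = f(x) + ε` of the first `t` rounds. -/
def obs (f : X → ℝ) (x : ℕ → Ω → X) (ε : ℕ → Ω → ℝ) (t : ℕ) (w : Ω) : Fin t → ℝ :=
  fun i => f (x i w) + ε i w

/-- Posterior mean after the first `t` rounds. -/
def runMean (k : X → X → ℝ) (lam : ℝ) (f : X → ℝ) (x : ℕ → Ω → X) (ε : ℕ → Ω → ℝ)
    (t : ℕ) (w : Ω) (z : X) : ℝ :=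
  postMean k lam (pts x t w) (obs f x ε t w) z

/-- Expected-improvement acquisition function of the round that follows the first `t` rounds. -/
def acquisition (k : X → X → ℝ) (lam δ : ℝ) (f : X → ℝ) (x : ℕ → Ω → X) (ε : ℕ → Ω → ℝ)
    (t : ℕ) (w : Ω) (z : X) : ℝ :=
  rho (runMean k lam f x ε t w z - incumbent k lam (pts x t w) (obs f x ε t w))
    (scale k lam δ t * postStd k lam (pts x t w) z)

/-- Cumulative regret `∑_{t ≤ n} (sup f - f(x_t⁺))` of the first `n` reported points. -/
def regret (f : X → ℝ) (xrep : ℕ → Ω → X) (n : ℕ) (w : Ω) : ℝ :=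
  ∑ t ∈ Finset.range n, ((⨆ z, f z) - f (xrep t w))

variable [mΩ : MeasurableSpace Ω]

/-- During the first `T` rounds the noise is adapted and conditionally `R`-sub-Gaussian. `ℱ t` is
the information that is available just before the observation of round `t`. -/
structure CondSubGaussianNoise (P : Measure Ω) (ℱ : Filtration ℕ mΩ) (R : ℝ) (T : ℕ)
    (ε : ℕ → Ω → ℝ) : Prop where
  adapted : ∀ t < T, Measurable[ℱ (t + 1)] (ε t)
  integrable : ∀ t < T, ∀ s : ℝ, Integrable (fun w => Real.exp (s * ε t w)) P
  condExp_le : ∀ t < T, ∀ s : ℝ,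
    P[fun w => Real.exp (s * ε t w) | ℱ t] ≤ᵐ[P] fun _ => Real.exp (s ^ 2 * R ^ 2 / 2)

/-- A run of the GP-EI algorithm over `T` rounds on the objective `f`, with the noise `ε`, the
sampled points `x` and the reported points `xrep`. Ties may be broken in any non-anticipating
measurable way. -/
structure IsRun [MeasurableSpace X] (ℱ : Filtration ℕ mΩ) (k : X → X → ℝ) (lam δ : ℝ)
    (f : X → ℝ) (T : ℕ) (ε : ℕ → Ω → ℝ) (x xrep : ℕ → Ω → X) : Prop where
  /-- Each point is chosen from the information available at that time. -/
  predictable : ∀ t < T, Measurable[ℱ t] (x t)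
  /-- Each sampled point maximizes the acquisition function over `X`. -/
  isMax : ∀ t < T, ∀ w, ∀ z : X,
    acquisition k lam δ f x ε t w z ≤ acquisition k lam δ f x ε t w (x t w)
  measurable_report : ∀ t < T, Measurable (xrep t)
  /-- The reported point of each round maximizes the posterior mean that was used in this round
  over the points sampled up to and including this round. -/
  report : ∀ t < T, ∀ w, ∃ i ≤ t, xrep t w = x i w ∧
    ∀ j ≤ t, runMean k lam f x ε t w (x j w) ≤ runMean k lam f x ε t w (x i w)

end Runs

end GPEI

end

/-! Feature vectors `φ z` of norm at most 1 turn posterior statements into Hilbert space geometry: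
`postVar` is a squared distance from `φ z` to a combination of sampled features plus a noise term.
Bordering the matrix `K + λ I` by one row gives Schur complement `λ + postVar`. Hence the
information gain grows by `log (1 + postVar / λ) / 2` per round, and the quadratic form in the noise
has an equally explicit increment.

Confidence. Cauchy-Schwarz bounds `|f - μ_t|` by `(B + √(noiseForm / λ)) σ_t`
(`abs_sub_postMean_le`). The process `exp (noiseForm / (2 R²) - infoGain)` is a supermartingale: its
one-step factor is a Gaussian mixture of factors `exp (g ε - g² R² / 2)` with `g` known in advance
(`selfNormalized_succ`). Ville's inequality then gives `noiseForm ≤ 2 R² (infoGain + log (1 / δ))`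
in all rounds at once, so `|f - μ_t| ≤ c ω_t σ_t` with `c = B + R √(2 / λ₀)`. The closed form of
`infoGain` is compared with `γ_t` by computing the Kullback-Leibler divergence from Gaussian
densities.

Regret. For `v > 0`, `rho u v = v τ(u / v)` with `τ(s) = 𝔼 (s - Z)⁺` increasing, so an optimistic
improvement `u + c v` costs at most the constant factor `1 + c / τ(-c)` over `rho u v`
(`add_mul_le_rho`). Maximality of the acquisition at `x_t` bounds the regret of a round by the
positive part `u_t` of the mean improvement and by `ω_t σ_t(x_t)` (`round_regret_le`). The
improvements telescope, because the next incumbent is higher by `u_t` up to two confidence widths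
(`incumbent_add_le`). The deviations are summed by Cauchy-Schwarz from `∑ σ_t² ≤ 2 (1 + λ₁) γ_n`.
Since one observation already gives `k(z, z) ≤ 2 (1 + λ₁) γ_n`, the boundary term of the telescope,
of the size of `sup |f|`, also carries a factor `√γ_n`. This yields `β_n √(n γ_n)`.

For the bound `γ_n √n`, either the kernel vanishes on the diagonal and `f = 0`, or `γ_n` is bounded
below for `n ≥ 1` and `β_n` is at most a multiple of `√γ_n`. There `R` is replaced by `R + 1`, which
covers `R = 0`. -/

namespace GPEI

/-! ### Linear algebra of bordered matrices -/

section BorderedMatrix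

open Matrix

variable {t : ℕ}

/-- The determinant of a bordered matrix, through the Schur complement of the leading block. -/
theorem det_of_bordered {A : Matrix (Fin t) (Fin t) ℝ}
    {A' : Matrix (Fin (t + 1)) (Fin (t + 1)) ℝ} {b : Fin t → ℝ}
    (hA : IsUnit A.det) (h1 : ∀ i j, A' i.castSucc j.castSucc = A i j)
    (h2 : ∀ i, A' i.castSucc (Fin.last t) = b i) (h3 : ∀ i, A' (Fin.last t) i.castSucc = b i) :
    A'.det = A.det * (A' (Fin.last t) (Fin.last t) - b ⬝ᵥ (A⁻¹ *ᵥ b)) := by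
  have : Invertible A := invertibleOfIsUnitDet A hA
  have hE : A' = (fromBlocks A (of fun i _ => b i) (of fun _ i => b i)
      (of fun _ _ : Fin 1 => A' (Fin.last t) (Fin.last t))).submatrix
      finSumFinEquiv.symm finSumFinEquiv.symm := by
    ext i j
    refine Fin.lastCases ?_ (fun i => ?_) i <;> refine Fin.lastCases ?_ (fun j => ?_) j <;>
      simp [h1, h2, h3]
  rw [hE, det_submatrix_equiv_self, det_fromBlocks₁₁, det_fin_one]
  congr 1
  rw [← hE]
  simp [Matrix.mul_apply, dotProduct, mulVec, Finset.sum_mul, Finset.mul_sum]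
  rw [Finset.sum_comm]
  exact Finset.sum_congr rfl fun i _ => Finset.sum_congr rfl fun j _ => by ring

/-- The inverse quadratic form of a bordered symmetric matrix. -/
theorem inv_quadForm_of_bordered {A : Matrix (Fin t) (Fin t) ℝ}
    {A' : Matrix (Fin (t + 1)) (Fin (t + 1)) ℝ} {b : Fin t → ℝ}
    (hA : IsUnit A.det) (hsymm : A.IsSymm)
    (h1 : ∀ i j, A' i.castSucc j.castSucc = A i j)
    (h2 : ∀ i, A' i.castSucc (Fin.last t) = b i) (h3 : ∀ i, A' (Fin.last t) i.castSucc = b i)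
    (hs : A' (Fin.last t) (Fin.last t) - b ⬝ᵥ (A⁻¹ *ᵥ b) ≠ 0) (v : Fin (t + 1) → ℝ) :
    v ⬝ᵥ (A'⁻¹ *ᵥ v) =
      (fun i : Fin t => v i.castSucc) ⬝ᵥ (A⁻¹ *ᵥ fun i : Fin t => v i.castSucc) +
      (v (Fin.last t) - b ⬝ᵥ (A⁻¹ *ᵥ fun i : Fin t => v i.castSucc)) ^ 2 /
        (A' (Fin.last t) (Fin.last t) - b ⬝ᵥ (A⁻¹ *ᵥ b)) := by
  have hdet : IsUnit A'.det := by
    rw [det_of_bordered hA h1 h2 h3]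
    exact hA.mul (isUnit_iff_ne_zero.mpr hs)
  set u : Fin t → ℝ := fun i => v i.castSucc with hu
  set d := A' (Fin.last t) (Fin.last t) with hd
  set s := d - b ⬝ᵥ (A⁻¹ *ᵥ b) with hsdef
  -- Block elimination for `A' y = v`: `r` is the last coordinate of the solution and `w` the
  -- others.
  set r : ℝ := (v (Fin.last t) - b ⬝ᵥ (A⁻¹ *ᵥ u)) / s with hr
  set w : Fin t → ℝ := A⁻¹ *ᵥ u - r • (A⁻¹ *ᵥ b) with hw
  have hAw : A *ᵥ w = u - r • b := by
    rw [hw, mulVec_sub, mulVec_smul, mulVec_mulVec, mulVec_mulVec, mul_nonsing_inv _ hA]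
    simp
  have hbw : b ⬝ᵥ w = b ⬝ᵥ (A⁻¹ *ᵥ u) - r * (b ⬝ᵥ (A⁻¹ *ᵥ b)) := by
    rw [hw, dotProduct_sub, dotProduct_smul, smul_eq_mul]
  have hsol : A' *ᵥ (Fin.snoc w r : Fin (t + 1) → ℝ) = v := by
    ext i
    refine Fin.lastCases ?_ (fun i => ?_) i
    · simp only [mulVec, dotProduct, Fin.sum_univ_castSucc, Fin.snoc_castSucc, Fin.snoc_last, h3]
      change b ⬝ᵥ w + d * r = _
      have : r * s = v (Fin.last t) - b ⬝ᵥ (A⁻¹ *ᵥ u) := div_mul_cancel₀ _ hs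
      rw [hsdef] at this
      rw [hbw]; linarith
    · simp only [mulVec, dotProduct, Fin.sum_univ_castSucc, Fin.snoc_castSucc, Fin.snoc_last, h1,
        h2]
      have := congrFun hAw i
      simp only [mulVec, dotProduct, Pi.sub_apply, Pi.smul_apply, smul_eq_mul] at this
      rw [this, hu]; ring
  have hinv : A'⁻¹ *ᵥ v = (Fin.snoc w r : Fin (t + 1) → ℝ) := by
    rw [← hsol, mulVec_mulVec, nonsing_inv_mul _ hdet, one_mulVec]
  have hub : u ⬝ᵥ (A⁻¹ *ᵥ b) = b ⬝ᵥ (A⁻¹ *ᵥ u) := by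
    have hT : (A⁻¹)ᵀ = A⁻¹ := by rw [transpose_nonsing_inv, hsymm.eq]
    rw [dotProduct_mulVec, ← mulVec_transpose, hT, dotProduct_comm]
  have hsplit : v ⬝ᵥ (Fin.snoc w r : Fin (t + 1) → ℝ) = u ⬝ᵥ w + v (Fin.last t) * r := by
    simp [dotProduct, Fin.sum_univ_castSucc, hu]
  rw [hinv, hsplit, hw, dotProduct_sub, dotProduct_smul, smul_eq_mul, hub, hr]
  field_simp
  ring

end BorderedMatrix

/-! ### Posterior mean, posterior variance and information gain -/

section Posterior

open Matrix

variable {X H : Type*} [NormedAddCommGroup H] [InnerProductSpace ℝ H] {k : X → X → ℝ} {φ : X → H}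
  {lam : ℝ} {t : ℕ}

/-- The regularized kernel matrix `K + λ I`. -/
noncomputable def regMatrix (k : X → X → ℝ) (lam : ℝ) {t : ℕ} (x : Fin t → X) :
    Matrix (Fin t) (Fin t) ℝ :=
  kernelMatrix k x + lam • (1 : Matrix (Fin t) (Fin t) ℝ)

/-- The mutual information `½ log det (I + K / λ)` between the values of the process at `x` and
the corresponding noisy observations, in closed form. -/
noncomputable def infoGain (k : X → X → ℝ) (lam : ℝ) {t : ℕ} (x : Fin t → X) : ℝ :=
  Real.log ((regMatrix k lam x).det / lam ^ t) / 2

theorem dotProduct_kernelMatrix_mulVec (hk : ∀ x z, k x z = inner ℝ (φ x) (φ z))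
    (x : Fin t → X) (v w : Fin t → ℝ) :
    v ⬝ᵥ (kernelMatrix k x *ᵥ w) = inner ℝ (∑ i, v i • φ (x i)) (∑ i, w i • φ (x i)) := by
  simp only [dotProduct, mulVec, kernelMatrix, of_apply, sum_inner, inner_sum, inner_smul_left,
    inner_smul_right, hk, Finset.mul_sum]
  rw [Finset.sum_comm]
  exact Finset.sum_congr rfl fun i _ => Finset.sum_congr rfl fun j _ => by simp; ring

theorem kernelMatrix_isSymm (hk : ∀ x z, k x z = inner ℝ (φ x) (φ z)) (x : Fin t → X) :
    (kernelMatrix k x).IsSymm := by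
  ext i j
  simp [kernelMatrix, hk, real_inner_comm]

theorem kernelMatrix_posSemidef (hk : ∀ x z, k x z = inner ℝ (φ x) (φ z)) (x : Fin t → X) :
    (kernelMatrix k x).PosSemidef := by
  refine PosSemidef.of_dotProduct_mulVec_nonneg ?_ fun v => ?_
  · rw [IsHermitian, conjTranspose_eq_transpose_of_trivial]
    exact kernelMatrix_isSymm hk x
  · rw [star_trivial, dotProduct_kernelMatrix_mulVec hk]
    exact real_inner_self_nonneg

theorem regMatrix_posDef (hk : ∀ x z, k x z = inner ℝ (φ x) (φ z)) (hlam : 0 < lam)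
    (x : Fin t → X) : (regMatrix k lam x).PosDef :=
  (PosDef.one.smul hlam).posSemidef_add (kernelMatrix_posSemidef hk x)

theorem regMatrix_isSymm (hk : ∀ x z, k x z = inner ℝ (φ x) (φ z)) (x : Fin t → X) :
    (regMatrix k lam x).IsSymm :=
  (kernelMatrix_isSymm hk x).add (isSymm_one.smul lam)

theorem regMatrix_isUnit_det (hk : ∀ x z, k x z = inner ℝ (φ x) (φ z)) (hlam : 0 < lam)
    (x : Fin t → X) : IsUnit (regMatrix k lam x).det :=
  isUnit_iff_ne_zero.mpr (regMatrix_posDef hk hlam x).det_pos.ne'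

theorem regMatrix_mulVec (x : Fin t → X) (v : Fin t → ℝ) :
    regMatrix k lam x *ᵥ v = kernelMatrix k x *ᵥ v + lam • v := by
  rw [regMatrix, add_mulVec, smul_mulVec, one_mulVec]

/-- Write `K = (K + λ I) - λ I`. This identity replaces every product with the possibly singular `K`
below. -/
theorem kernelMatrix_mulVec_inv (hk : ∀ x z, k x z = inner ℝ (φ x) (φ z)) (hlam : 0 < lam)
    (x : Fin t → X) (v : Fin t → ℝ) :
    kernelMatrix k x *ᵥ ((regMatrix k lam x)⁻¹ *ᵥ v) =
      v - lam • ((regMatrix k lam x)⁻¹ *ᵥ v) := by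
  rw [eq_sub_iff_add_eq, ← regMatrix_mulVec, mulVec_mulVec,
    mul_nonsing_inv _ (regMatrix_isUnit_det hk hlam x), one_mulVec]

theorem dotProduct_inv_regMatrix_comm (hk : ∀ x z, k x z = inner ℝ (φ x) (φ z))
    (x : Fin t → X) (v w : Fin t → ℝ) :
    v ⬝ᵥ ((regMatrix k lam x)⁻¹ *ᵥ w) = w ⬝ᵥ ((regMatrix k lam x)⁻¹ *ᵥ v) := by
  have hT : ((regMatrix k lam x)⁻¹)ᵀ = (regMatrix k lam x)⁻¹ := by
    rw [transpose_nonsing_inv, (regMatrix_isSymm hk x).eq]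
  rw [dotProduct_mulVec, ← mulVec_transpose, hT, dotProduct_comm]

theorem inner_sum_feature (hk : ∀ x z, k x z = inner ℝ (φ x) (φ z))
    (x : Fin t → X) (v : Fin t → ℝ) (z : X) :
    inner ℝ (φ z) (∑ i, v i • φ (x i)) = kernelVec k x z ⬝ᵥ v := by
  simp only [inner_sum, inner_smul_right, dotProduct, kernelVec, hk]
  exact Finset.sum_congr rfl fun i _ => mul_comm _ _

/-- The posterior variance as a squared distance in the feature space plus the contribution of the
noise. -/
theorem postVar_eq (hk : ∀ x z, k x z = inner ℝ (φ x) (φ z)) (hlam : 0 < lam)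
    (x : Fin t → X) (z : X) :
    postVar k lam x z =
      ‖φ z - ∑ i, ((regMatrix k lam x)⁻¹ *ᵥ kernelVec k x z) i • φ (x i)‖ ^ 2 +
      lam * ∑ i, ((regMatrix k lam x)⁻¹ *ᵥ kernelVec k x z) i ^ 2 := by
  set α := (regMatrix k lam x)⁻¹ *ᵥ kernelVec k x z with hα
  have h1 : α ⬝ᵥ (kernelMatrix k x *ᵥ α) = α ⬝ᵥ kernelVec k x z - lam * ∑ i, α i ^ 2 := by
    rw [hα, kernelMatrix_mulVec_inv hk hlam, ← hα, dotProduct_sub, dotProduct_smul]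
    simp [dotProduct, pow_two]
  rw [norm_sub_sq_real, inner_sum_feature hk, ← real_inner_self_eq_norm_sq, ← hk,
    ← real_inner_self_eq_norm_sq, ← dotProduct_kernelMatrix_mulVec hk, h1, postVar, ← regMatrix,
    ← hα, dotProduct_comm α]
  ring

theorem postVar_nonneg (hk : ∀ x z, k x z = inner ℝ (φ x) (φ z)) (hlam : 0 < lam)
    (x : Fin t → X) (z : X) : 0 ≤ postVar k lam x z := by
  rw [postVar_eq hk hlam]
  have : 0 ≤ ∑ i, ((regMatrix k lam x)⁻¹ *ᵥ kernelVec k x z) i ^ 2 :=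
    Finset.sum_nonneg fun i _ => sq_nonneg _
  positivity

theorem postStd_sq (hk : ∀ x z, k x z = inner ℝ (φ x) (φ z)) (hlam : 0 < lam)
    (x : Fin t → X) (z : X) : postStd k lam x z ^ 2 = postVar k lam x z :=
  Real.sq_sqrt (postVar_nonneg hk hlam x z)

theorem postStd_nonneg (x : Fin t → X) (z : X) : 0 ≤ postStd k lam x z := Real.sqrt_nonneg _

theorem norm_residual_le_postStd (hk : ∀ x z, k x z = inner ℝ (φ x) (φ z)) (hlam : 0 < lam)
    (x : Fin t → X) (z : X) :
    ‖φ z - ∑ i, ((regMatrix k lam x)⁻¹ *ᵥ kernelVec k x z) i • φ (x i)‖ ≤ postStd k lam x z := by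
  apply Real.le_sqrt_of_sq_le
  rw [postVar_eq hk hlam]
  have : 0 ≤ ∑ i, ((regMatrix k lam x)⁻¹ *ᵥ kernelVec k x z) i ^ 2 :=
    Finset.sum_nonneg fun i _ => sq_nonneg _
  nlinarith

/-- The self-normalized quadratic form `vᵀ K (K + λ I)⁻¹ v`. -/
noncomputable def noiseForm (k : X → X → ℝ) (lam : ℝ) {t : ℕ} (x : Fin t → X) (v : Fin t → ℝ) : ℝ :=
  v ⬝ᵥ v - lam * (v ⬝ᵥ ((regMatrix k lam x)⁻¹ *ᵥ v))

theorem noiseForm_eq (hk : ∀ x z, k x z = inner ℝ (φ x) (φ z)) (hlam : 0 < lam)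
    (x : Fin t → X) (v : Fin t → ℝ) :
    noiseForm k lam x v = v ⬝ᵥ (kernelMatrix k x *ᵥ ((regMatrix k lam x)⁻¹ *ᵥ v)) := by
  rw [kernelMatrix_mulVec_inv hk hlam, dotProduct_sub, dotProduct_smul, noiseForm, smul_eq_mul]

theorem postMean_add (x : Fin t → X) (u v : Fin t → ℝ) (z : X) :
    postMean k lam x (fun i => u i + v i) z = postMean k lam x u z + postMean k lam x v z := by
  rw [postMean, postMean, postMean, ← dotProduct_add, ← mulVec_add]; rfl

/-- The posterior mean of pure noise is controlled by the posterior variance and the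
self-normalized quadratic form of the noise. -/
theorem postMean_sq_le (hk : ∀ x z, k x z = inner ℝ (φ x) (φ z)) (hlam : 0 < lam)
    (x : Fin t → X) (v : Fin t → ℝ) (z : X) :
    postMean k lam x v z ^ 2 ≤ postVar k lam x z * (noiseForm k lam x v / lam) := by
  set α := (regMatrix k lam x)⁻¹ *ᵥ kernelVec k x z with hα
  set β := (regMatrix k lam x)⁻¹ *ᵥ v with hβ
  set g := φ z - ∑ i, α i • φ (x i) with hg
  set h := ∑ i, β i • φ (x i) with hh
  have hKβ : kernelMatrix k x *ᵥ β = v - lam • β := kernelMatrix_mulVec_inv hk hlam x v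
  have hpm : postMean k lam x v z = kernelVec k x z ⬝ᵥ β := rfl
  have hαv : α ⬝ᵥ v = kernelVec k x z ⬝ᵥ β := by
    rw [dotProduct_comm, hα, hβ, dotProduct_inv_regMatrix_comm hk]
  have hgh : inner ℝ g h = lam * (α ⬝ᵥ β) := by
    rw [hg, inner_sub_left, inner_sum_feature hk, hh, ← dotProduct_kernelMatrix_mulVec hk, hKβ,
      dotProduct_sub, dotProduct_smul, hαv, smul_eq_mul]
    ring
  -- Both factors of the claim become squared norms in `H × ℝᵗ`: here from `v = K β + λ β`, and for
  -- the variance from `postVar_eq`.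
  have hQ : noiseForm k lam x v / lam = ‖h‖ ^ 2 + (∑ i, (kernelMatrix k x *ᵥ β) i ^ 2) / lam := by
    have h1 : ‖h‖ ^ 2 = β ⬝ᵥ (kernelMatrix k x *ᵥ β) := by
      rw [dotProduct_kernelMatrix_mulVec hk, real_inner_self_eq_norm_sq]
    have h2 : ∑ i, (kernelMatrix k x *ᵥ β) i ^ 2 =
        (kernelMatrix k x *ᵥ β) ⬝ᵥ (kernelMatrix k x *ᵥ β) := by
      simp [dotProduct, pow_two]
    have h3 : v = kernelMatrix k x *ᵥ β + lam • β := by rw [hKβ]; simp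
    have h4 : v ⬝ᵥ (kernelMatrix k x *ᵥ β) =
        (kernelMatrix k x *ᵥ β) ⬝ᵥ (kernelMatrix k x *ᵥ β) +
          lam * (β ⬝ᵥ (kernelMatrix k x *ᵥ β)) := by
      rw [← smul_eq_mul, ← smul_dotProduct, ← add_dotProduct, ← h3]
    rw [noiseForm_eq hk hlam, h1, h2, ← hβ, h4]
    field_simp
    ring
  -- The mean is `⟨φ z, h⟩`; splitting `φ z` into `g` and the combination with weights `α` exhibits
  -- it as the matching inner product in `H × ℝᵗ`.
  have hmean : postMean k lam x v z = inner ℝ g h + ∑ i, α i * (kernelMatrix k x *ᵥ β) i := by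
    change _ = _ + α ⬝ᵥ (kernelMatrix k x *ᵥ β)
    rw [hgh, hKβ, dotProduct_sub, dotProduct_smul, hpm, hαv, smul_eq_mul]
    ring
  have hcs1 : (inner ℝ g h) ^ 2 ≤ ‖g‖ ^ 2 * ‖h‖ ^ 2 := by
    rw [← mul_pow]
    exact sq_le_sq' (neg_le_of_abs_le (abs_real_inner_le_norm g h)) (real_inner_le_norm g h)
  have hcs2 := Finset.sum_mul_sq_le_sq_mul_sq Finset.univ α (kernelMatrix k x *ᵥ β)
  rw [hmean, hQ, postVar_eq hk hlam, ← hα, ← hg]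
  set a := inner ℝ g h
  set b := ∑ i, α i * (kernelMatrix k x *ᵥ β) i
  set p := ∑ i, α i ^ 2
  set q := ∑ i, (kernelMatrix k x *ᵥ β) i ^ 2
  have hp : 0 ≤ p := Finset.sum_nonneg fun i _ => sq_nonneg _
  have hq : 0 ≤ q := Finset.sum_nonneg fun i _ => sq_nonneg _
  have hq' : 0 ≤ q / lam := div_nonneg hq hlam.le
  have hb : b ^ 2 ≤ (lam * p) * (q / lam) := by
    calc b ^ 2 ≤ p * q := hcs2
      _ = _ := by field_simp
  -- Cross term of the Cauchy-Schwarz inequality in the product space, by the arithmetic-geometric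
  -- mean inequality.
  have hab : 2 * (a * b) ≤ ‖g‖ ^ 2 * (q / lam) + lam * p * ‖h‖ ^ 2 := by
    have h1 : (a * b) ^ 2 ≤ (‖g‖ ^ 2 * (q / lam)) * (lam * p * ‖h‖ ^ 2) := by
      calc (a * b) ^ 2 = a ^ 2 * b ^ 2 := by ring
        _ ≤ (‖g‖ ^ 2 * ‖h‖ ^ 2) * ((lam * p) * (q / lam)) :=
          mul_le_mul hcs1 hb (sq_nonneg _) (by positivity)
        _ = _ := by ring
    have h2 : 0 ≤ ‖g‖ ^ 2 * (q / lam) := by positivity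
    have h3 : 0 ≤ lam * p * ‖h‖ ^ 2 := by positivity
    refine le_of_abs_le (abs_le_of_sq_le_sq ?_ (by positivity))
    nlinarith [sq_nonneg (‖g‖ ^ 2 * (q / lam) - lam * p * ‖h‖ ^ 2)]
  nlinarith

/-- Confidence bound for a function in the reproducing kernel Hilbert space. -/
theorem abs_sub_postMean_le (hk : ∀ x z, k x z = inner ℝ (φ x) (φ z)) (hlam : 0 < lam)
    (x : Fin t → X) (v : Fin t → ℝ) (f : H) (z : X) :
    |inner ℝ (φ z) f - postMean k lam x (fun i => inner ℝ (φ (x i)) f + v i) z| ≤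
      (‖f‖ + Real.sqrt (noiseForm k lam x v / lam)) * postStd k lam x z := by
  set α := (regMatrix k lam x)⁻¹ *ᵥ kernelVec k x z with hα
  -- With noiseless data the error is the pairing of `f` with the residual of `φ z`, whose norm is
  -- at most the posterior deviation.
  have h1 : inner ℝ (φ z) f - postMean k lam x (fun i => inner ℝ (φ (x i)) f) z =
      inner ℝ (φ z - ∑ i, α i • φ (x i)) f := by
    rw [inner_sub_left, sum_inner, postMean, ← regMatrix, dotProduct_inv_regMatrix_comm hk, ← hα]
    simp [dotProduct, inner_smul_left, mul_comm]
  have h2 : |inner ℝ (φ z) f - postMean k lam x (fun i => inner ℝ (φ (x i)) f) z| ≤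
      ‖f‖ * postStd k lam x z := by
    rw [h1, mul_comm]
    exact (abs_real_inner_le_norm _ _).trans
      (mul_le_mul_of_nonneg_right (norm_residual_le_postStd hk hlam x z) (norm_nonneg _))
  have h3 : |postMean k lam x v z| ≤
      Real.sqrt (noiseForm k lam x v / lam) * postStd k lam x z := by
    rw [mul_comm, postStd, ← Real.sqrt_mul (postVar_nonneg hk hlam x z)]
    exact Real.abs_le_sqrt (postMean_sq_le hk hlam x v z)
  rw [postMean_add, ← sub_sub, add_mul]
  exact (abs_sub _ _).trans (add_le_add h2 h3)

section Step

variable (x : Fin (t + 1) → X)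

theorem regMatrix_schur (x' : Fin t → X) (z : X) :
    k z z + lam - kernelVec k x' z ⬝ᵥ ((regMatrix k lam x')⁻¹ *ᵥ kernelVec k x' z) =
      lam + postVar k lam x' z := by
  rw [postVar, ← regMatrix]; ring

theorem regMatrix_castSucc (i j : Fin t) : regMatrix k lam x i.castSucc j.castSucc =
    regMatrix k lam (fun i : Fin t => x i.castSucc) i j := by
  simp [regMatrix, kernelMatrix, one_apply]

theorem regMatrix_last_castSucc (i : Fin t) : regMatrix k lam x (Fin.last t) i.castSucc =
    kernelVec k (fun i : Fin t => x i.castSucc) (x (Fin.last t)) i := by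
  simp [regMatrix, kernelMatrix, one_apply, kernelVec, (Fin.castSucc_lt_last i).ne']

theorem regMatrix_castSucc_last (hk : ∀ x z, k x z = inner ℝ (φ x) (φ z)) (i : Fin t) :
    regMatrix k lam x i.castSucc (Fin.last t) =
      kernelVec k (fun i : Fin t => x i.castSucc) (x (Fin.last t)) i := by
  rw [← (regMatrix_isSymm hk x).apply, regMatrix_last_castSucc]

theorem regMatrix_last_last : regMatrix k lam x (Fin.last t) (Fin.last t) =
    k (x (Fin.last t)) (x (Fin.last t)) + lam := by
  simp [regMatrix, kernelMatrix]

theorem det_regMatrix_succ (hk : ∀ x z, k x z = inner ℝ (φ x) (φ z)) (hlam : 0 < lam) :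
    (regMatrix k lam x).det = (regMatrix k lam (fun i : Fin t => x i.castSucc)).det *
      (lam + postVar k lam (fun i : Fin t => x i.castSucc) (x (Fin.last t))) := by
  rw [det_of_bordered (regMatrix_isUnit_det hk hlam _) (regMatrix_castSucc x)
    (regMatrix_castSucc_last x hk) (regMatrix_last_castSucc x), regMatrix_last_last,
    regMatrix_schur]

theorem inv_regMatrix_quadForm_succ (hk : ∀ x z, k x z = inner ℝ (φ x) (φ z)) (hlam : 0 < lam)
    (v : Fin (t + 1) → ℝ) :
    v ⬝ᵥ ((regMatrix k lam x)⁻¹ *ᵥ v) =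
      (fun i : Fin t => v i.castSucc) ⬝ᵥ
        ((regMatrix k lam (fun i : Fin t => x i.castSucc))⁻¹ *ᵥ fun i : Fin t => v i.castSucc) +
      (v (Fin.last t) - postMean k lam (fun i : Fin t => x i.castSucc)
        (fun i : Fin t => v i.castSucc) (x (Fin.last t))) ^ 2 /
      (lam + postVar k lam (fun i : Fin t => x i.castSucc) (x (Fin.last t))) := by
  have hpos := postVar_nonneg hk hlam (fun i : Fin t => x i.castSucc) (x (Fin.last t))
  rw [inv_quadForm_of_bordered (regMatrix_isUnit_det hk hlam _) (regMatrix_isSymm hk _)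
    (regMatrix_castSucc x) (regMatrix_castSucc_last x hk) (regMatrix_last_castSucc x),
    regMatrix_last_last, regMatrix_schur]
  · rfl
  · rw [regMatrix_last_last, regMatrix_schur]
    positivity

/-- The bordered inverse form adds a square over a positive Schur complement, and this form is
subtracted in the variance. -/
theorem postVar_succ_le (hk : ∀ x z, k x z = inner ℝ (φ x) (φ z)) (hlam : 0 < lam) (z : X) :
    postVar k lam x z ≤ postVar k lam (fun i : Fin t => x i.castSucc) z := by
  have hpos := postVar_nonneg hk hlam (fun i : Fin t => x i.castSucc) (x (Fin.last t))
  rw [postVar, ← regMatrix, inv_regMatrix_quadForm_succ x hk hlam, postVar, ← regMatrix]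
  have : 0 ≤ (kernelVec k x z (Fin.last t) - postMean k lam (fun i : Fin t => x i.castSucc)
        (fun i : Fin t => kernelVec k x z i.castSucc) (x (Fin.last t))) ^ 2 /
      (lam + postVar k lam (fun i : Fin t => x i.castSucc) (x (Fin.last t))) := by positivity
  change k z z - (_ + _) ≤ k z z - kernelVec k x z ∘ Fin.castSucc ⬝ᵥ _
  simp only [Function.comp_def] at *
  exact sub_le_sub_left (le_add_of_nonneg_right this) _

theorem postStd_succ_le (hk : ∀ x z, k x z = inner ℝ (φ x) (φ z)) (hlam : 0 < lam) (z : X) :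
    postStd k lam x z ≤ postStd k lam (fun i : Fin t => x i.castSucc) z :=
  Real.sqrt_le_sqrt (postVar_succ_le x hk hlam z)

theorem noiseForm_succ (hk : ∀ x z, k x z = inner ℝ (φ x) (φ z)) (hlam : 0 < lam)
    (v : Fin (t + 1) → ℝ) :
    noiseForm k lam x v =
      noiseForm k lam (fun i : Fin t => x i.castSucc) (fun i : Fin t => v i.castSucc) +
      (v (Fin.last t) ^ 2 - lam * ((v (Fin.last t) -
        postMean k lam (fun i : Fin t => x i.castSucc)
          (fun i : Fin t => v i.castSucc) (x (Fin.last t))) ^ 2 /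
        (lam + postVar k lam (fun i : Fin t => x i.castSucc) (x (Fin.last t))))) := by
  rw [noiseForm, inv_regMatrix_quadForm_succ x hk hlam, noiseForm]
  simp only [dotProduct, Fin.sum_univ_castSucc]
  ring

/-- Chain rule for the gain: the determinant is multiplied by the Schur complement `λ + postVar`,
and the normalization by `λ`. -/
theorem infoGain_succ (hk : ∀ x z, k x z = inner ℝ (φ x) (φ z)) (hlam : 0 < lam) :
    infoGain k lam x = infoGain k lam (fun i : Fin t => x i.castSucc) +
      Real.log (1 + postVar k lam (fun i : Fin t => x i.castSucc) (x (Fin.last t)) / lam) / 2 := by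
  have hpos := postVar_nonneg hk hlam (fun i : Fin t => x i.castSucc) (x (Fin.last t))
  have hd := (regMatrix_posDef hk hlam (fun i : Fin t => x i.castSucc)).det_pos
  rw [infoGain, infoGain, ← add_div, ← Real.log_mul (by positivity) (by positivity),
    det_regMatrix_succ x hk hlam]
  congr 2
  field_simp
  ring

end Step

theorem infoGain_zero (x : Fin 0 → X) : infoGain k lam x = 0 := by
  simp [infoGain]

theorem infoGain_le_succ (hk : ∀ x z, k x z = inner ℝ (φ x) (φ z)) (hlam : 0 < lam)
    (x : Fin (t + 1) → X) : infoGain k lam (fun i : Fin t => x i.castSucc) ≤ infoGain k lam x := by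
  rw [infoGain_succ x hk hlam]
  have hpos := postVar_nonneg hk hlam (fun i : Fin t => x i.castSucc) (x (Fin.last t))
  have : 0 ≤ Real.log (1 + postVar k lam (fun i : Fin t => x i.castSucc) (x (Fin.last t)) / lam) :=
    Real.log_nonneg (by have := div_nonneg hpos hlam.le; linarith)
  linarith

theorem postVar_le (hk : ∀ x z, k x z = inner ℝ (φ x) (φ z)) (hlam : 0 < lam) :
    ∀ {t : ℕ} (x : Fin t → X) (z : X), postVar k lam x z ≤ k z z
  | 0, x, z => by simp [postVar, dotProduct]
  | _ + 1, x, z => (postVar_succ_le x hk hlam z).trans (postVar_le hk hlam _ z)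

/-- Each round contributes at most `1 / (2 λ)` by `log (1 + s) ≤ s`. The crude linear bound serves
only to make the supremum of the gains finite. -/
theorem infoGain_le (hk : ∀ x z, k x z = inner ℝ (φ x) (φ z)) (hlam : 0 < lam)
    (hk1 : ∀ z, k z z ≤ 1) :
    ∀ {t : ℕ} (x : Fin t → X), infoGain k lam x ≤ t * (1 / (2 * lam))
  | 0, x => by simp [infoGain_zero]
  | t + 1, x => by
    rw [infoGain_succ x hk hlam]
    have h1 := infoGain_le hk hlam hk1 (fun i : Fin t => x i.castSucc)
    have hpos := postVar_nonneg hk hlam (fun i : Fin t => x i.castSucc) (x (Fin.last t))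
    have hle := (postVar_le hk hlam (fun i : Fin t => x i.castSucc) (x (Fin.last t))).trans (hk1 _)
    set s := postVar k lam (fun i : Fin t => x i.castSucc) (x (Fin.last t))
    have h2 : Real.log (1 + s / lam) ≤ s / lam := by
      have := Real.log_le_sub_one_of_pos (show 0 < 1 + s / lam by positivity)
      linarith
    have h3 : s / lam ≤ 1 / lam := by gcongr
    have h4 : 1 / (2 * lam) = 1 / lam / 2 := by field_simp
    push_cast
    rw [h4] at h1 ⊢
    linarith

end Posterior

/-! ### Lebesgue densities of Gaussian vectors -/

section GaussianDensity

open Matrix WithLp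
open scoped RealInnerProductSpace MatrixOrder

variable {ι : Type*} [Fintype ι]

theorem map_withDensity_comp {α β : Type*} [MeasurableSpace α] [MeasurableSpace β]
    (μ : Measure α) {T : α → β} (hT : Measurable T) {h : β → ENNReal} (hh : Measurable h) :
    (μ.withDensity fun x => h (T x)).map T = (μ.map T).withDensity h := by
  ext s hs
  rw [Measure.map_apply hT hs, withDensity_apply _ (hT hs), withDensity_apply _ hs,
    setLIntegral_map hs hh hT]

/-- The standard Gaussian measure has a density with respect to Lebesgue measure. -/
theorem exists_stdGaussian_eq_withDensity : ∃ c : ℝ, 0 < c ∧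
    stdGaussian (EuclideanSpace ℝ ι) =
      volume.withDensity fun x => ENNReal.ofReal (c * Real.exp (-‖x‖ ^ 2 / 2)) := by
  set E := EuclideanSpace ℝ ι
  set I : ℝ := ∫ x : E, Real.exp (-(1 / 2) * ‖x‖ ^ 2) with hI
  have hI0 : 0 < I := by
    rw [hI, GaussianFourier.integral_rexp_neg_mul_sq_norm (by norm_num)]
    positivity
  have hre : 0 < ((1 / 2 : ℝ) : ℂ).re := by norm_num
  have hZ : ((Real.pi : ℂ) / ((1 / 2 : ℝ) : ℂ)) ^ (Module.finrank ℝ E / 2 : ℂ) = (I : ℂ) := by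
    rw [← GaussianFourier.integral_cexp_neg_mul_sq_norm (V := E) hre, hI, ← integral_complex_ofReal]
    congr 1; ext x; push_cast; rfl
  have hint : Integrable (fun x : E => Real.exp (-‖x‖ ^ 2 / 2)) := by
    have := (GaussianFourier.integrable_cexp_neg_mul_sq_norm_add hre 0 (0 : E)).norm
    refine this.congr (Filter.Eventually.of_forall fun x => ?_)
    simp only [Complex.norm_exp]
    congr 1
    simp [← Complex.ofReal_pow]
    ring
  have hfin : IsFiniteMeasure
      (volume.withDensity fun x : E => ENNReal.ofReal (I⁻¹ * Real.exp (-‖x‖ ^ 2 / 2))) :=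
    isFiniteMeasure_withDensity_ofReal (hint.const_mul _).2
  -- Both measures are finite, so agreement of characteristic functions, a Gaussian Fourier
  -- integral, identifies them.
  refine ⟨I⁻¹, inv_pos.mpr hI0, Measure.ext_of_charFun (funext fun t => ?_)⟩
  rw [charFun_stdGaussian, charFun_apply, integral_withDensity_eq_integral_toReal_smul
    (by fun_prop) (by simp)]
  have : ∀ x : E, (ENNReal.ofReal (I⁻¹ * Real.exp (-‖x‖ ^ 2 / 2))).toReal •
      Complex.exp (⟪x, t⟫ * Complex.I) = (I : ℂ)⁻¹ *
        Complex.exp (-((1 / 2 : ℝ) : ℂ) * ‖x‖ ^ 2 + Complex.I * ⟪t, x⟫) := by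
    intro x
    rw [ENNReal.toReal_ofReal (by positivity), Complex.exp_add, Complex.real_smul,
      real_inner_comm x t]
    push_cast
    rw [mul_assoc]
    congr 3
    · ring
    · ring
  simp_rw [this]
  rw [integral_const_mul, GaussianFourier.integral_cexp_neg_mul_sq_norm_add hre, hZ, ← mul_assoc,
    inv_mul_cancel₀ (by exact_mod_cast hI0.ne'), one_mul]
  congr 1
  push_cast
  rw [Complex.I_sq]
  ring

variable [DecidableEq ι]

theorem det_toEuclideanCLM (M : Matrix ι ι ℝ) :
    LinearMap.det (toEuclideanCLM (𝕜 := ℝ) M : EuclideanSpace ℝ ι →ₗ[ℝ] EuclideanSpace ℝ ι) =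
      M.det := by
  rw [coe_toEuclideanCLM_eq_toEuclideanLin]
  exact (congrArg LinearMap.det (DFunLike.congr_fun (toLpLin_eq_toLin 2 2) M)).trans
    (LinearMap.det_toLin _ M)

theorem sqrt_mul_sqrt {S : Matrix ι ι ℝ} (hS : S.PosSemidef) :
    CFC.sqrt S * CFC.sqrt S = S := CFC.sqrt_mul_sqrt_self _ hS.nonneg

theorem abs_det_sqrt {S : Matrix ι ι ℝ} (hS : S.PosSemidef) :
    |(CFC.sqrt S).det| = Real.sqrt S.det := by
  rw [← Real.sqrt_sq_eq_abs, pow_two, ← det_mul, sqrt_mul_sqrt hS]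

theorem sqrt_transpose (S : Matrix ι ι ℝ) : (CFC.sqrt S)ᵀ = CFC.sqrt S := by
  rw [← conjTranspose_eq_transpose_of_trivial]
  exact (CFC.sqrt_nonneg S).isSelfAdjoint

/-- The inverse quadratic form of the covariance turns the square root of the covariance into the
Euclidean norm. -/
theorem inv_quadForm_sqrt_mulVec {S : Matrix ι ι ℝ} (hS : S.PosDef) (x : ι → ℝ) :
    (CFC.sqrt S *ᵥ x) ⬝ᵥ (S⁻¹ *ᵥ (CFC.sqrt S *ᵥ x)) = x ⬝ᵥ x := by
  have hu : IsUnit (CFC.sqrt S).det := by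
    rw [isUnit_iff_ne_zero, ← abs_pos, abs_det_sqrt hS.posSemidef]
    exact Real.sqrt_pos.mpr hS.det_pos
  have h : S⁻¹ * CFC.sqrt S = (CFC.sqrt S)⁻¹ := by
    conv_lhs => rw [← sqrt_mul_sqrt hS.posSemidef, Matrix.mul_inv_rev, Matrix.mul_assoc]
    rw [sqrt_mul_sqrt hS.posSemidef, nonsing_inv_mul _ hu, Matrix.mul_one]
  rw [mulVec_mulVec, h, dotProduct_mulVec, ← mulVec_transpose, transpose_nonsing_inv,
    sqrt_transpose, mulVec_mulVec, nonsing_inv_mul _ hu, one_mulVec]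

variable (ι) in
/-- Lebesgue density of the nondegenerate multivariate Gaussian measures, up to a constant that
depends on the dimension only. -/
theorem exists_multivariateGaussian_eq_withDensity : ∃ c : ℝ, 0 < c ∧
    ∀ (S : Matrix ι ι ℝ), S.PosDef → ∀ m : EuclideanSpace ℝ ι,
      multivariateGaussian m S = volume.withDensity fun y =>
        ENNReal.ofReal (c / Real.sqrt S.det *
          Real.exp (-(ofLp (y - m) ⬝ᵥ (S⁻¹ *ᵥ ofLp (y - m))) / 2)) := by
  obtain ⟨c, hc, hstd⟩ := exists_stdGaussian_eq_withDensity (ι := ι)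
  refine ⟨c, hc, fun S hS m => ?_⟩
  set M := toEuclideanCLM (𝕜 := ℝ) (CFC.sqrt S) with hM
  have hdet : LinearMap.det (M : EuclideanSpace ℝ ι →ₗ[ℝ] EuclideanSpace ℝ ι) =
    (CFC.sqrt S).det := det_toEuclideanCLM _
  have hdet0 : LinearMap.det (M : EuclideanSpace ℝ ι →ₗ[ℝ] EuclideanSpace ℝ ι) ≠ 0 := by
    rw [hdet, ← abs_pos, abs_det_sqrt hS.posSemidef]
    exact Real.sqrt_pos.mpr hS.det_pos
  have hT : Measurable fun x => m + M x := by fun_prop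
  have hquad : Measurable fun y : EuclideanSpace ℝ ι => ofLp (y - m) ⬝ᵥ (S⁻¹ *ᵥ ofLp (y - m)) := by
    have : (fun y : EuclideanSpace ℝ ι => ofLp (y - m) ⬝ᵥ (S⁻¹ *ᵥ ofLp (y - m))) =
        fun y => ⟪y - m, toEuclideanCLM (𝕜 := ℝ) S⁻¹ (y - m)⟫ := by
      ext y; rw [inner_toEuclideanCLM]
    rw [this]; fun_prop
  set h : EuclideanSpace ℝ ι → ENNReal := fun y =>
    ENNReal.ofReal (c * Real.exp (-(ofLp (y - m) ⬝ᵥ (S⁻¹ *ᵥ ofLp (y - m))) / 2)) with hh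
  have hhm : Measurable h := by fun_prop
  have hcomp : (fun x => ENNReal.ofReal (c * Real.exp (-‖x‖ ^ 2 / 2))) = fun x => h (m + M x) := by
    ext x
    have : ofLp (m + M x - m) ⬝ᵥ (S⁻¹ *ᵥ ofLp (m + M x - m)) = ‖x‖ ^ 2 := by
      rw [add_sub_cancel_left, hM, ofLp_toEuclideanCLM, inv_quadForm_sqrt_mulVec hS,
        EuclideanSpace.real_norm_sq_eq]
      simp [dotProduct, pow_two]
    simp only [hh, this]
  -- The affine change of variables rescales Lebesgue measure by `|det √S|⁻¹ = (√(det S))⁻¹`.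
  have hvol : (volume : Measure (EuclideanSpace ℝ ι)).map (fun x => m + M x) =
      ENNReal.ofReal (Real.sqrt S.det)⁻¹ • volume := by
    have : (fun x => m + M x) = (fun x => m + x) ∘ M := rfl
    rw [this, ← Measure.map_map (by fun_prop) (by fun_prop)]
    have h2 := Measure.map_linearMap_addHaar_eq_smul_addHaar
      (volume : Measure (EuclideanSpace ℝ ι)) hdet0
    rw [hdet, abs_inv, abs_det_sqrt hS.posSemidef] at h2
    change (Measure.map (M : EuclideanSpace ℝ ι →ₗ[ℝ] EuclideanSpace ℝ ι) volume).map _ = _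
    rw [h2, Measure.map_smul, (measurePreserving_add_left volume m).map_eq]
  rw [multivariateGaussian, hstd, hcomp, map_withDensity_comp _ hT hhm, hvol,
    withDensity_smul_measure, ← withDensity_smul _ hhm]
  congr 1
  ext y
  simp only [hh, Pi.smul_apply, smul_eq_mul]
  rw [← ENNReal.ofReal_mul (by positivity)]
  congr 1
  ring

/-- The expected inverse quadratic form of a nondegenerate centred Gaussian vector is its
dimension. -/
theorem integrable_inv_quadForm_multivariateGaussian {S : Matrix ι ι ℝ} (hS : S.PosDef) :
    Integrable (fun y : EuclideanSpace ℝ ι => ofLp y ⬝ᵥ (S⁻¹ *ᵥ ofLp y))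
      (multivariateGaussian 0 S) ∧
    ∫ y, ofLp y ⬝ᵥ (S⁻¹ *ᵥ ofLp y) ∂(multivariateGaussian 0 S) = Fintype.card ι := by
  set M := toEuclideanCLM (𝕜 := ℝ) (CFC.sqrt S) with hM
  have hT : Measurable fun x => 0 + M x := by fun_prop
  have hquad : Measurable fun y : EuclideanSpace ℝ ι => ofLp y ⬝ᵥ (S⁻¹ *ᵥ ofLp y) := by
    have : (fun y : EuclideanSpace ℝ ι => ofLp y ⬝ᵥ (S⁻¹ *ᵥ ofLp y)) =
        fun y => ⟪y, toEuclideanCLM (𝕜 := ℝ) S⁻¹ y⟫ := by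
      ext y; rw [inner_toEuclideanCLM]
    rw [this]; fun_prop
  -- In whitened coordinates the form is a sum of squares of standard normal variables, each of mean
  -- 1.
  have hcomp : ∀ x, ofLp (0 + M x) ⬝ᵥ (S⁻¹ *ᵥ ofLp (0 + M x)) = ∑ i, x i ^ 2 := by
    intro x
    rw [zero_add, hM, ofLp_toEuclideanCLM, inv_quadForm_sqrt_mulVec hS]
    simp [dotProduct, pow_two]
  have hL2 : ∀ i, MemLp (fun x : EuclideanSpace ℝ ι => x i) 2
      (stdGaussian (EuclideanSpace ℝ ι)) := fun i => by
    have h2 : MemLp id 2 (stdGaussian (EuclideanSpace ℝ ι)) := IsGaussian.memLp_two_id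
    exact (EuclideanSpace.proj (𝕜 := ℝ) i).comp_memLp' h2
  have hvar : ∀ i, ∫ x : EuclideanSpace ℝ ι, x i ^ 2 ∂(stdGaussian (EuclideanSpace ℝ ι)) = 1 := by
    intro i
    have h1 := variance_eval_multivariateGaussian (μ := (0 : EuclideanSpace ℝ ι))
      (S := (1 : Matrix ι ι ℝ)) PosSemidef.one i
    rw [multivariateGaussian_zero_one, variance_of_integral_eq_zero (by fun_prop)] at h1
    · simpa using h1
    · exact integral_strongDual_stdGaussian (EuclideanSpace.proj (𝕜 := ℝ) i)
  constructor
  · rw [multivariateGaussian, integrable_map_measure hquad.aestronglyMeasurable hT.aemeasurable]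
    refine (integrable_finsetSum Finset.univ fun i _ => (hL2 i).integrable_sq).congr
      (Filter.Eventually.of_forall fun x => ?_)
    exact (hcomp x).symm
  · rw [multivariateGaussian, integral_map hT.aemeasurable hquad.aestronglyMeasurable]
    refine (integral_congr_ae (Filter.Eventually.of_forall hcomp)).trans ?_
    rw [integral_finsetSum _ fun i _ => (hL2 i).integrable_sq]
    simp [hvar]

end GaussianDensity

/-! ### Mutual information of a Gaussian signal and its noisy observation -/

section MutualInformation

open Matrix WithLp InformationTheory
open scoped RealInnerProductSpace MatrixOrder

variable {ι : Type*} [Fintype ι] [DecidableEq ι]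

theorem measurable_quadForm {α : Type*} [MeasurableSpace α] (S : Matrix ι ι ℝ)
    {g : α → EuclideanSpace ℝ ι} (hg : Measurable g) :
    Measurable fun a => ofLp (g a) ⬝ᵥ (S *ᵥ ofLp (g a)) := by
  have : (fun a => ofLp (g a) ⬝ᵥ (S *ᵥ ofLp (g a))) =
      fun a => ⟪g a, toEuclideanCLM (𝕜 := ℝ) S (g a)⟫ := by
    ext a; rw [inner_toEuclideanCLM]
  rw [this]; fun_prop

theorem multivariateGaussian_map_const_add (m : EuclideanSpace ℝ ι) (S : Matrix ι ι ℝ) :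
    (multivariateGaussian 0 S).map (fun x => m + x) = multivariateGaussian m S := by
  rw [multivariateGaussian, Measure.map_map (by fun_prop) (by fun_prop), multivariateGaussian]
  congr 1
  ext x
  simp

/-- The sum of two independent centred Gaussian vectors is a Gaussian vector. -/
theorem multivariateGaussian_prod_map_add {S S' : Matrix ι ι ℝ} (hS : S.PosSemidef)
    (hS' : S'.PosSemidef) :
    ((multivariateGaussian 0 S).prod (multivariateGaussian 0 S')).map (fun p => p.1 + p.2) =
      multivariateGaussian 0 (S + S') := by
  change (multivariateGaussian 0 S).conv (multivariateGaussian 0 S') = _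
  refine Measure.ext_of_charFun (funext fun t => ?_)
  rw [charFun_conv, charFun_multivariateGaussian hS, charFun_multivariateGaussian hS',
    charFun_multivariateGaussian (hS.add hS'), ← Complex.exp_add, add_mulVec, dotProduct_add]
  congr 1
  push_cast
  simp
  ring

/-- Joint law of a centred Gaussian vector with covariance `S` and of its sum with an independent
centred Gaussian vector with covariance `S'`: its density with respect to the product of the
marginal laws. -/
theorem gaussian_signal_noise_eq_withDensity {S S' : Matrix ι ι ℝ} (hS : S.PosSemidef)
    (hS' : S'.PosDef) :
    ((multivariateGaussian 0 S).prod (multivariateGaussian 0 S')).map (fun p => (p.1, p.1 + p.2)) =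
      ((multivariateGaussian 0 S).prod (multivariateGaussian 0 (S + S'))).withDensity fun p =>
        ENNReal.ofReal (Real.exp (Real.log ((S + S').det / S'.det) / 2
          - ofLp (p.2 - p.1) ⬝ᵥ (S'⁻¹ *ᵥ ofLp (p.2 - p.1)) / 2
          + ofLp p.2 ⬝ᵥ ((S + S')⁻¹ *ᵥ ofLp p.2) / 2)) := by
  obtain ⟨c, hc, hdens⟩ := exists_multivariateGaussian_eq_withDensity ι
  have hA : (S + S').PosDef := hS'.posSemidef_add hS
  set r : EuclideanSpace ℝ ι × EuclideanSpace ℝ ι → ENNReal := fun p =>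
    ENNReal.ofReal (Real.exp (Real.log ((S + S').det / S'.det) / 2
      - ofLp (p.2 - p.1) ⬝ᵥ (S'⁻¹ *ᵥ ofLp (p.2 - p.1)) / 2
      + ofLp p.2 ⬝ᵥ ((S + S')⁻¹ *ᵥ ofLp p.2) / 2)) with hr
  have hq1 : Measurable fun p : EuclideanSpace ℝ ι × EuclideanSpace ℝ ι =>
      ofLp (p.2 - p.1) ⬝ᵥ (S'⁻¹ *ᵥ ofLp (p.2 - p.1)) :=
    measurable_quadForm _ (measurable_snd.sub measurable_fst)
  have hq2 : Measurable fun p : EuclideanSpace ℝ ι × EuclideanSpace ℝ ι =>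
      ofLp p.2 ⬝ᵥ ((S + S')⁻¹ *ᵥ ofLp p.2) := measurable_quadForm _ measurable_snd
  have hrm : Measurable r := by fun_prop
  have hd0 : Measurable fun y : EuclideanSpace ℝ ι =>
      ENNReal.ofReal (c / Real.sqrt (S + S').det *
        Real.exp (-(ofLp (y - 0) ⬝ᵥ ((S + S')⁻¹ *ᵥ ofLp (y - 0))) / 2)) := by
    have := measurable_quadForm (S + S')⁻¹
      (measurable_id.sub_const (0 : EuclideanSpace ℝ ι))
    simp only [id] at this
    fun_prop
  -- Given the signal `f`, the observation has law `N(f, S')`; `r (f, y)` is its density ratio to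
  -- the marginal `N(0, S + S')`. The signal itself needs no Lebesgue density, so `S` may be
  -- singular.
  have hpoint : ∀ f y : EuclideanSpace ℝ ι,
      ENNReal.ofReal (c / Real.sqrt S'.det *
        Real.exp (-(ofLp (y - f) ⬝ᵥ (S'⁻¹ *ᵥ ofLp (y - f))) / 2)) =
      ENNReal.ofReal (c / Real.sqrt (S + S').det *
        Real.exp (-(ofLp (y - 0) ⬝ᵥ ((S + S')⁻¹ *ᵥ ofLp (y - 0))) / 2)) * r (f, y) := by
    intro f y
    have h1 := hA.det_pos
    have h2 := hS'.det_pos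
    rw [hr, ← ENNReal.ofReal_mul (by positivity)]
    congr 1
    have h3 : Real.exp (Real.log ((S + S').det / S'.det) / 2) =
        Real.sqrt (S + S').det / Real.sqrt S'.det := by
      rw [← Real.sqrt_div h1.le, Real.sqrt_eq_rpow, Real.rpow_def_of_pos (by positivity)]
      congr 1; ring
    rw [Real.exp_add, Real.exp_sub, h3, neg_div, neg_div, Real.exp_neg, Real.exp_neg, sub_zero]
    have h4 := Real.sqrt_pos.mpr h1
    have h5 := Real.sqrt_pos.mpr h2
    field_simp
  ext s hs
  have hT : Measurable fun p : EuclideanSpace ℝ ι × EuclideanSpace ℝ ι => (p.1, p.1 + p.2) := by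
    fun_prop
  rw [Measure.map_apply hT hs, Measure.prod_apply (hT hs), withDensity_apply _ hs,
    ← lintegral_indicator hs, lintegral_prod _ (hrm.indicator hs).aemeasurable]
  refine lintegral_congr fun f => ?_
  have hsf : MeasurableSet (Prod.mk f ⁻¹' s) := measurable_prodMk_left hs
  have h1 : (multivariateGaussian 0 S') (Prod.mk f ⁻¹' ((fun p : EuclideanSpace ℝ ι ×
      EuclideanSpace ℝ ι => (p.1, p.1 + p.2)) ⁻¹' s)) =
      multivariateGaussian f S' (Prod.mk f ⁻¹' s) := by
    rw [← multivariateGaussian_map_const_add f S', Measure.map_apply (by fun_prop) hsf]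
    rfl
  rw [h1, hdens S' hS' f, withDensity_apply _ hsf, ← lintegral_indicator hsf, hdens _ hA 0,
    lintegral_withDensity_eq_lintegral_mul _ hd0
      (show Measurable fun y => s.indicator r (f, y) from
        (hrm.indicator hs).comp measurable_prodMk_left)]
  refine lintegral_congr fun y => ?_
  by_cases hy : (f, y) ∈ s
  · have hy' : y ∈ Prod.mk f ⁻¹' s := hy
    rw [Set.indicator_of_mem hy', hpoint]
    simp [Set.indicator_of_mem hy]
  · have hy' : y ∉ Prod.mk f ⁻¹' s := hy
    rw [Set.indicator_of_notMem hy']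
    simp [Set.indicator_of_notMem hy]

/-- Mutual information of a centred Gaussian vector and of its sum with independent Gaussian
noise. -/
theorem mutualInfo_gaussian_signal_noise {S S' : Matrix ι ι ℝ} (hS : S.PosSemidef)
    (hS' : S'.PosDef) :
    mutualInfo (((multivariateGaussian 0 S).prod (multivariateGaussian 0 S')).map
      fun p => (p.1, p.1 + p.2)) = ENNReal.ofReal (Real.log ((S + S').det / S'.det) / 2) := by
  set P := ((multivariateGaussian 0 S).prod (multivariateGaussian 0 S')).map
    fun p => (p.1, p.1 + p.2) with hP
  have hT : Measurable fun p : EuclideanSpace ℝ ι × EuclideanSpace ℝ ι => (p.1, p.1 + p.2) := by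
    fun_prop
  have hA : (S + S').PosDef := hS'.posSemidef_add hS
  have hPprob : IsProbabilityMeasure P := Measure.isProbabilityMeasure_map hT.aemeasurable
  have hfst : P.fst = multivariateGaussian 0 S := by
    rw [hP, Measure.fst, Measure.map_map measurable_fst hT]
    exact Measure.fst_prod
  have hsnd : P.snd = multivariateGaussian 0 (S + S') := by
    rw [hP, Measure.snd, Measure.map_map measurable_snd hT]
    exact multivariateGaussian_prod_map_add hS hS'.posSemidef
  set L := Real.log ((S + S').det / S'.det) / 2 with hL
  set ℓ : EuclideanSpace ℝ ι × EuclideanSpace ℝ ι → ℝ := fun p =>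
    L - ofLp (p.2 - p.1) ⬝ᵥ (S'⁻¹ *ᵥ ofLp (p.2 - p.1)) / 2
      + ofLp p.2 ⬝ᵥ ((S + S')⁻¹ *ᵥ ofLp p.2) / 2 with hℓ
  have hq1 : Measurable fun p : EuclideanSpace ℝ ι × EuclideanSpace ℝ ι =>
      ofLp (p.2 - p.1) ⬝ᵥ (S'⁻¹ *ᵥ ofLp (p.2 - p.1)) :=
    measurable_quadForm _ (measurable_snd.sub measurable_fst)
  have hq2 : Measurable fun p : EuclideanSpace ℝ ι × EuclideanSpace ℝ ι =>
      ofLp p.2 ⬝ᵥ ((S + S')⁻¹ *ᵥ ofLp p.2) := measurable_quadForm _ measurable_snd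
  have hℓm : Measurable fun p => ENNReal.ofReal (Real.exp (ℓ p)) := by fun_prop
  have hdens : P = (P.fst.prod P.snd).withDensity fun p => ENNReal.ofReal (Real.exp (ℓ p)) := by
    rw [hfst, hsnd]; exact gaussian_signal_noise_eq_withDensity hS hS'
  have hac : P ≪ P.fst.prod P.snd := by
    conv_lhs => rw [hdens]
    exact withDensity_absolutelyContinuous _ _
  have hllr : llr P (P.fst.prod P.snd) =ᵐ[P] ℓ := by
    have h1 : P.rnDeriv (P.fst.prod P.snd) =ᵐ[P.fst.prod P.snd]
        fun p => ENNReal.ofReal (Real.exp (ℓ p)) := by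
      have h2 := Measure.rnDeriv_withDensity (P.fst.prod P.snd) hℓm
      rwa [← hdens] at h2
    filter_upwards [hac.ae_le h1] with p hp
    rw [llr, hp, ENNReal.toReal_ofReal (Real.exp_pos _).le, Real.log_exp]
  have hI1 : Integrable (fun p : EuclideanSpace ℝ ι × EuclideanSpace ℝ ι =>
      ofLp (p.2 - p.1) ⬝ᵥ (S'⁻¹ *ᵥ ofLp (p.2 - p.1))) P ∧
      ∫ p, ofLp (p.2 - p.1) ⬝ᵥ (S'⁻¹ *ᵥ ofLp (p.2 - p.1)) ∂P = Fintype.card ι := by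
    obtain ⟨h1, h2⟩ := integrable_inv_quadForm_multivariateGaussian hS'
    rw [hP, integrable_map_measure hq1.aestronglyMeasurable hT.aemeasurable,
      integral_map hT.aemeasurable hq1.aestronglyMeasurable]
    simp only [Function.comp_def, add_sub_cancel_left]
    exact ⟨h1.comp_snd _, by rw [integral_fun_snd (fun e : EuclideanSpace ℝ ι =>
      ofLp e ⬝ᵥ (S'⁻¹ *ᵥ ofLp e)), h2]; simp⟩
  have hI2 : Integrable (fun p : EuclideanSpace ℝ ι × EuclideanSpace ℝ ι =>
      ofLp p.2 ⬝ᵥ ((S + S')⁻¹ *ᵥ ofLp p.2)) P ∧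
      ∫ p, ofLp p.2 ⬝ᵥ ((S + S')⁻¹ *ᵥ ofLp p.2) ∂P = Fintype.card ι := by
    obtain ⟨h1, h2⟩ := integrable_inv_quadForm_multivariateGaussian hA
    have hm : Measurable fun y : EuclideanSpace ℝ ι => ofLp y ⬝ᵥ ((S + S')⁻¹ *ᵥ ofLp y) :=
      measurable_quadForm _ measurable_id
    rw [← hsnd, Measure.snd, integrable_map_measure hm.aestronglyMeasurable
      measurable_snd.aemeasurable] at h1
    rw [← hsnd, Measure.snd, integral_map measurable_snd.aemeasurable
      hm.aestronglyMeasurable] at h2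
    exact ⟨h1, h2⟩
  have hint : Integrable ℓ P :=
    ((integrable_const L).sub (hI1.1.div_const 2)).add (hI2.1.div_const 2)
  -- Both quadratic forms have mean equal to the dimension, so they cancel and only the
  -- log-determinant remains.
  have hval : ∫ p, ℓ p ∂P = L := by
    refine (integral_add ((integrable_const L).sub (hI1.1.div_const 2))
      (hI2.1.div_const 2)).trans ?_
    rw [integral_sub' (integrable_const L) (hI1.1.div_const 2), integral_div, integral_div, hI1.2,
      integral_div, hI2.2]
    simp [hL]
  rw [mutualInfo, klDiv_of_ac_of_integrable hac ((integrable_congr hllr).mpr hint),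
    integral_congr_ae hllr, hval]
  simp

end MutualInformation

/-! ### The maximum information gain -/

section MaxInfoGain

open Matrix

variable {X H : Type*} [NormedAddCommGroup H] [InnerProductSpace ℝ H] {k : X → X → ℝ} {φ : X → H}
  {lam : ℝ} {t : ℕ}

theorem mutualInfo_obsLaw (hk : ∀ x z, k x z = inner ℝ (φ x) (φ z)) (hlam : 0 < lam)
    (A : Fin t → X) : mutualInfo (obsLaw k lam A) = ENNReal.ofReal (infoGain k lam A) := by
  rw [obsLaw, mutualInfo_gaussian_signal_noise (kernelMatrix_posSemidef hk A)
    (PosDef.one.smul hlam), infoGain, regMatrix]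
  simp

theorem infoGain_nonneg (hk : ∀ x z, k x z = inner ℝ (φ x) (φ z)) (hlam : 0 < lam) :
    ∀ {t : ℕ} (x : Fin t → X), 0 ≤ infoGain k lam x
  | 0, x => (infoGain_zero x).ge
  | _ + 1, x => (infoGain_nonneg hk hlam _).trans (infoGain_le_succ hk hlam x)

/-- Without finiteness, `toReal` would send the supremum to 0 and `maxInfoGain` would bound nothing.
-/
theorem iSup_mutualInfo_ne_top (hk : ∀ x z, k x z = inner ℝ (φ x) (φ z)) (hlam : 0 < lam)
    (hk1 : ∀ z, k z z ≤ 1) (t : ℕ) :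
    (⨆ A : Fin t → X, mutualInfo (obsLaw k lam A)) ≠ ⊤ := by
  refine ne_top_of_le_ne_top (b := ENNReal.ofReal (t * (1 / (2 * lam)))) ENNReal.ofReal_ne_top ?_
  refine iSup_le fun A => ?_
  rw [mutualInfo_obsLaw hk hlam]
  exact ENNReal.ofReal_le_ofReal (infoGain_le hk hlam hk1 A)

theorem infoGain_le_maxInfoGain (hk : ∀ x z, k x z = inner ℝ (φ x) (φ z)) (hlam : 0 < lam)
    (hk1 : ∀ z, k z z ≤ 1) (A : Fin t → X) : infoGain k lam A ≤ maxInfoGain k lam t := by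
  rw [maxInfoGain, ← ENNReal.ofReal_le_iff_le_toReal (iSup_mutualInfo_ne_top hk hlam hk1 t),
    ← mutualInfo_obsLaw hk hlam]
  exact le_iSup (fun A : Fin t → X => mutualInfo (obsLaw k lam A)) A

theorem maxInfoGain_nonneg : 0 ≤ maxInfoGain k lam t := ENNReal.toReal_nonneg

theorem maxInfoGain_mono [Nonempty X] (hk : ∀ x z, k x z = inner ℝ (φ x) (φ z)) (hlam : 0 < lam)
    (hk1 : ∀ z, k z z ≤ 1) : Monotone (maxInfoGain k lam) := by
  refine monotone_nat_of_le_succ fun t => ?_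
  rw [maxInfoGain]
  refine ENNReal.toReal_le_of_le_ofReal maxInfoGain_nonneg (iSup_le fun A => ?_)
  rw [mutualInfo_obsLaw hk hlam]
  refine ENNReal.ofReal_le_ofReal ?_
  have h := infoGain_le_succ hk hlam (Fin.snoc A (Classical.arbitrary X) : Fin (t + 1) → X)
  simp only [Fin.snoc_castSucc] at h
  exact h.trans (infoGain_le_maxInfoGain hk hlam hk1 _)

end MaxInfoGain

/-! ### Ville's maximal inequality -/

section Ville

variable {Ω : Type*} {mΩ : MeasurableSpace Ω} {P : Measure Ω}
  {ℱ : Filtration ℕ mΩ}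

/-- Ville's maximal inequality for a nonnegative supermartingale over finitely many steps. -/
theorem measure_exists_le_of_supermartingale {M : ℕ → Ω → ENNReal} {T : ℕ} {c : ENNReal}
    (hM : ∀ t ≤ T, Measurable[ℱ t] (M t)) (h0 : ∫⁻ w, M 0 w ∂P ≤ 1)
    (hstep : ∀ t < T, ∀ A, MeasurableSet[ℱ t] A → ∫⁻ w in A, M (t + 1) w ∂P ≤ ∫⁻ w in A, M t w ∂P) :
    c * P {w | ∃ t ≤ T, c ≤ M t w} ≤ 1 := by
  have hMm : ∀ t ≤ T, Measurable (M t) := fun t ht => (hM t ht).mono (ℱ.le t) le_rfl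
  set bad : ℕ → Set Ω := fun t => {w | ∃ s ≤ t, c ≤ M s w} with hbad
  have hbadm : ∀ t ≤ T, MeasurableSet[ℱ t] (bad t) := by
    intro t ht
    have : bad t = ⋃ s ∈ Finset.range (t + 1), {w | c ≤ M s w} := by
      ext w; simp [hbad]
    rw [this]
    refine Finset.measurableSet_biUnion _ fun s hs => ?_
    have hst : s ≤ t := Nat.lt_succ_iff.mp (Finset.mem_range.mp hs)
    exact measurableSet_le measurable_const ((hM s (hst.trans ht)).mono (ℱ.mono hst) le_rfl)
  -- The process is stopped, at value at least `c`, when it first reaches `c`. The left side is a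
  -- lower bound for the mean of the stopped process and does not increase with `t`.
  have hmain : ∀ t ≤ T, ∫⁻ w in (bad t)ᶜ, M t w ∂P + c * P (bad t) ≤ 1 := by
    intro t
    induction t with
    | zero =>
      intro _
      have hm := ℱ.le 0 _ (hbadm 0 (Nat.zero_le _))
      refine le_trans ?_ h0
      rw [← lintegral_add_compl (μ := P) (M 0) hm, add_comm]
      gcongr
      rw [← setLIntegral_const]
      refine setLIntegral_mono (hMm 0 (Nat.zero_le _)) fun w hw => ?_
      obtain ⟨s, hs, h⟩ := hw
      rwa [Nat.le_zero.mp hs] at h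
    | succ t ih =>
      intro ht
      have ht' : t < T := ht
      have hm := ℱ.le _ _ (hbadm t ht'.le)
      have hm1 := ℱ.le _ _ (hbadm (t + 1) ht)
      refine le_trans ?_ (ih ht'.le)
      have hsub : bad t ⊆ bad (t + 1) := fun w ⟨s, hs, h⟩ => ⟨s, hs.trans (Nat.le_succ t), h⟩
      have h1 := hstep t ht' _ (hbadm t ht'.le).compl
      have h2 : ∫⁻ w in (bad t)ᶜ, M (t + 1) w ∂P =
          ∫⁻ w in bad (t + 1) \ bad t, M (t + 1) w ∂P + ∫⁻ w in (bad (t + 1))ᶜ, M (t + 1) w ∂P := by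
        rw [← lintegral_union hm1.compl]
        · congr 2
          ext w
          have := @hsub w
          simp only [Set.mem_compl_iff, Set.mem_union, Set.mem_sdiff]
          tauto
        · exact Set.disjoint_left.mpr fun w hw hw' => hw' hw.1
      have h3 : c * P (bad (t + 1) \ bad t) ≤ ∫⁻ w in bad (t + 1) \ bad t, M (t + 1) w ∂P := by
        rw [← setLIntegral_const]
        refine setLIntegral_mono (hMm _ ht) fun w hw => ?_
        obtain ⟨⟨s, hs, h⟩, hnot⟩ := hw
        rcases Nat.lt_succ_iff_lt_or_eq.mp (Nat.lt_succ_iff.mpr hs) with h' | h'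
        · exact absurd ⟨s, Nat.lt_succ_iff.mp h', h⟩ hnot
        · rwa [h'] at h
      have h4 : P (bad (t + 1)) = P (bad (t + 1) \ bad t) + P (bad t) := by
        rw [← measure_inter_add_sdiff (bad (t + 1)) hm, Set.inter_eq_self_of_subset_right hsub,
          add_comm]
      calc ∫⁻ w in (bad (t + 1))ᶜ, M (t + 1) w ∂P + c * P (bad (t + 1))
          = (c * P (bad (t + 1) \ bad t) + ∫⁻ w in (bad (t + 1))ᶜ, M (t + 1) w ∂P) +
            c * P (bad t) := by rw [h4, mul_add]; ring
        _ ≤ (∫⁻ w in bad (t + 1) \ bad t, M (t + 1) w ∂P +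
            ∫⁻ w in (bad (t + 1))ᶜ, M (t + 1) w ∂P) + c * P (bad t) := by gcongr
        _ ≤ _ := by rw [← h2]; gcongr
  exact le_add_self.trans (hmain T le_rfl)

end Ville

/-! ### Exponential supermartingales and their Gaussian mixtures -/

section SubGaussian

variable {Ω : Type*} {m mΩ : MeasurableSpace Ω} {P : Measure Ω} [IsProbabilityMeasure P]

/-- Exponential supermartingale bound with a deterministic multiplier. -/
theorem lintegral_mul_exp_const_le (hm : m ≤ mΩ) {e : Ω → ℝ} {s v : ℝ} (he : Measurable e)
    (hint : Integrable (fun w => Real.exp (s * e w)) P)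
    (hcond : P[fun w => Real.exp (s * e w) | m] ≤ᵐ[P] fun _ => Real.exp v)
    {W : Ω → ENNReal} (hW : Measurable[m] W) :
    ∫⁻ w, W w * ENNReal.ofReal (Real.exp (s * e w - v)) ∂P ≤ ∫⁻ w, W w ∂P := by
  have hem : Measurable fun w => ENNReal.ofReal (Real.exp (s * e w - v)) := by fun_prop
  -- On the smaller σ-algebra the tilted measure is dominated by `P`. This lets `W` be any
  -- measurable weight, with no integrability.
  have hle : (P.withDensity fun w => ENNReal.ofReal (Real.exp (s * e w - v))).trim hm ≤
      P.trim hm := by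
    refine Measure.le_iff.mpr fun A hA => ?_
    rw [trim_measurableSet_eq hm hA, trim_measurableSet_eq hm hA, withDensity_apply _ (hm A hA)]
    have hint' : Integrable (fun w => Real.exp (s * e w - v)) P := by
      simp_rw [Real.exp_sub]; exact hint.div_const _
    rw [← ofReal_integral_eq_lintegral_ofReal hint'.integrableOn
      (Filter.Eventually.of_forall fun w => (Real.exp_pos _).le)]
    simp_rw [Real.exp_sub]
    rw [integral_div, ← setIntegral_condExp hm hint hA]
    have h1 : ∫ w in A, (P[fun w => Real.exp (s * e w) | m]) w ∂P ≤
        ∫ _ in A, Real.exp v ∂P :=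
      integral_mono_ae integrable_condExp.integrableOn (integrable_const _)
        (ae_restrict_of_ae hcond)
    rw [setIntegral_const, smul_eq_mul] at h1
    refine ENNReal.ofReal_le_of_le_toReal ?_
    rw [div_le_iff₀ (Real.exp_pos v)]
    exact h1
  calc ∫⁻ w, W w * ENNReal.ofReal (Real.exp (s * e w - v)) ∂P
      = ∫⁻ w, W w ∂(P.withDensity fun w => ENNReal.ofReal (Real.exp (s * e w - v))) := by
        rw [lintegral_withDensity_eq_lintegral_mul _ hem (hW.mono hm le_rfl)]
        exact lintegral_congr fun w => mul_comm _ _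
    _ = ∫⁻ w, W w ∂((P.withDensity fun w => ENNReal.ofReal (Real.exp (s * e w - v))).trim hm) :=
        (lintegral_trim hm hW).symm
    _ ≤ ∫⁻ w, W w ∂(P.trim hm) := lintegral_mono' hle le_rfl
    _ = _ := lintegral_trim hm hW

theorem exists_tendsto_finite_range {Ω : Type*} {_ : MeasurableSpace Ω} {g : Ω → ℝ}
    (hg : Measurable g) : ∃ h : ℕ → Ω → ℝ, (∀ n, Measurable (h n)) ∧
      (∀ n, (Set.range (h n)).Finite) ∧
      ∀ w, Filter.Tendsto (fun n => h n w) Filter.atTop (nhds (g w)) :=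
  ⟨fun n => hg.stronglyMeasurable.approx n, fun n => (hg.stronglyMeasurable.approx n).measurable,
    fun n => (hg.stronglyMeasurable.approx n).finite_range,
    hg.stronglyMeasurable.tendsto_approx⟩

/-- Exponential supermartingale bound with a multiplier that is known in advance. -/
theorem lintegral_mul_exp_le (hm : m ≤ mΩ) {e : Ω → ℝ} {R : ℝ} (he : Measurable e)
    (hint : ∀ s : ℝ, Integrable (fun w => Real.exp (s * e w)) P)
    (hcond : ∀ s : ℝ, P[fun w => Real.exp (s * e w) | m] ≤ᵐ[P] fun _ => Real.exp (s ^ 2 * R ^ 2 / 2))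
    {W : Ω → ENNReal} (hW : Measurable[m] W) {g : Ω → ℝ} (hg : Measurable[m] g) :
    ∫⁻ w, W w * ENNReal.ofReal (Real.exp (g w * e w - g w ^ 2 * R ^ 2 / 2)) ∂P ≤
      ∫⁻ w, W w ∂P := by
  have hWm : Measurable W := hW.mono hm le_rfl
  -- For finitely many values, split along the level sets of `h`, where the multiplier is constant.
  -- Fatou's lemma then passes to the limit.
  have hsimple : ∀ h : Ω → ℝ, Measurable[m] h → (Set.range h).Finite →
      ∫⁻ w, W w * ENNReal.ofReal (Real.exp (h w * e w - h w ^ 2 * R ^ 2 / 2)) ∂P ≤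
        ∫⁻ w, W w ∂P := by
    intro h hh hfin
    have hset : ∀ y, MeasurableSet[m] (h ⁻¹' {y}) := fun y => hh (measurableSet_singleton y)
    have hdecomp : ∀ F : Ω → ENNReal, ∀ w, F w = ∑ y ∈ hfin.toFinset, (h ⁻¹' {y}).indicator F w := by
      intro F w
      rw [Finset.sum_eq_single (h w)]
      · rw [Set.indicator_of_mem]; rfl
      · intro y _ hy
        exact Set.indicator_of_notMem (fun hw => hy hw.symm) _
      · intro hn
        exact absurd (hfin.mem_toFinset.mpr ⟨w, rfl⟩) hn
    have h1 : ∀ w, W w * ENNReal.ofReal (Real.exp (h w * e w - h w ^ 2 * R ^ 2 / 2)) =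
        ∑ y ∈ hfin.toFinset, (h ⁻¹' {y}).indicator W w *
          ENNReal.ofReal (Real.exp (y * e w - y ^ 2 * R ^ 2 / 2)) := by
      intro w
      rw [hdecomp (fun w => W w * ENNReal.ofReal (Real.exp (h w * e w - h w ^ 2 * R ^ 2 / 2))) w]
      refine Finset.sum_congr rfl fun y _ => ?_
      by_cases hw : w ∈ h ⁻¹' {y}
      · have : h w = y := hw
        rw [Set.indicator_of_mem hw, Set.indicator_of_mem hw, this]
      · rw [Set.indicator_of_notMem hw, Set.indicator_of_notMem hw, zero_mul]
    have h2 : ∀ y, Measurable ((h ⁻¹' {y}).indicator W) := fun y =>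
      hWm.indicator (hm _ (hset y))
    calc ∫⁻ w, W w * ENNReal.ofReal (Real.exp (h w * e w - h w ^ 2 * R ^ 2 / 2)) ∂P
        = ∑ y ∈ hfin.toFinset, ∫⁻ w, (h ⁻¹' {y}).indicator W w *
          ENNReal.ofReal (Real.exp (y * e w - y ^ 2 * R ^ 2 / 2)) ∂P := by
          simp_rw [h1]
          exact lintegral_finsetSum _ fun y _ => (h2 y).mul (by fun_prop)
      _ ≤ ∑ y ∈ hfin.toFinset, ∫⁻ w, (h ⁻¹' {y}).indicator W w ∂P :=
          Finset.sum_le_sum fun y _ => lintegral_mul_exp_const_le hm he (hint y) (hcond y)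
            (hW.indicator (hset y))
      _ = ∫⁻ w, W w ∂P := by
          rw [← lintegral_finsetSum _ fun y _ => h2 y]
          exact lintegral_congr fun w => (hdecomp W w).symm
  obtain ⟨h, hhm, hhfin, hhlim⟩ := exists_tendsto_finite_range hg
  have hlim : ∀ w, Filter.Tendsto (fun n => W w * ENNReal.ofReal
      (Real.exp (h n w * e w - h n w ^ 2 * R ^ 2 / 2))) Filter.atTop
      (nhds (W w * ENNReal.ofReal (Real.exp (g w * e w - g w ^ 2 * R ^ 2 / 2)))) := by
    intro w
    have h1 := hhlim w
    -- The limit of the second factor is nonzero, so the product converges even where `W w` is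
    -- infinite.
    refine ENNReal.Tendsto.const_mul (ENNReal.tendsto_ofReal ?_) (Or.inl ?_)
    · have hc : Continuous fun s : ℝ => Real.exp (s * e w - s ^ 2 * R ^ 2 / 2) := by fun_prop
      exact (hc.tendsto (g w)).comp h1
    · simp [Real.exp_pos]
  calc ∫⁻ w, W w * ENNReal.ofReal (Real.exp (g w * e w - g w ^ 2 * R ^ 2 / 2)) ∂P
      = ∫⁻ w, Filter.liminf (fun n => W w * ENNReal.ofReal
          (Real.exp (h n w * e w - h n w ^ 2 * R ^ 2 / 2))) Filter.atTop ∂P :=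
        lintegral_congr fun w => (hlim w).liminf_eq.symm
    _ ≤ Filter.liminf (fun n => ∫⁻ w, W w * ENNReal.ofReal
          (Real.exp (h n w * e w - h n w ^ 2 * R ^ 2 / 2)) ∂P) Filter.atTop := by
        refine lintegral_liminf_le fun n => hWm.mul ?_
        have : Measurable (h n) := (hhm n).mono hm le_rfl
        fun_prop
    _ ≤ ∫⁻ w, W w ∂P := by
        refine Filter.liminf_le_of_le (by isBoundedDefault) fun b hb => ?_
        obtain ⟨n, hn⟩ := hb.exists
        exact hn.trans (hsimple _ (hhm n) (hhfin n))

/-- The Gaussian mixture of the exponential supermartingales, in closed form. -/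
theorem lintegral_exp_gaussian_mixture {R a : ℝ} (hR : 0 < R) (ha : 0 ≤ a) (μ e : ℝ) :
    ∫⁻ ξ, ENNReal.ofReal (Real.exp ((μ + R * Real.sqrt a * ξ) / R ^ 2 * e -
        ((μ + R * Real.sqrt a * ξ) / R ^ 2) ^ 2 * R ^ 2 / 2)) ∂(gaussianReal 0 1) =
      ENNReal.ofReal (Real.exp ((e ^ 2 - (e - μ) ^ 2 / (1 + a)) / (2 * R ^ 2) -
        Real.log (1 + a) / 2)) := by
  have h1a : 0 < 1 + a := by linarith
  -- Completing the square in `ξ` leaves the density of a normal law with mean `b` and variance `v =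
  -- 1 / (1 + a)`; the leftover factor is `c`.
  set v : NNReal := ⟨(1 + a)⁻¹, by positivity⟩ with hv
  have hv0 : v ≠ 0 := by
    rw [← NNReal.coe_ne_zero]; exact (inv_pos.mpr h1a).ne'
  set c := Real.exp ((e ^ 2 - (e - μ) ^ 2 / (1 + a)) / (2 * R ^ 2) - Real.log (1 + a) / 2) with hc
  set b := Real.sqrt a * (e - μ) / R / (1 + a) with hb
  have hsq : Real.sqrt a ^ 2 = a := Real.sq_sqrt ha
  have hlog : Real.exp (-(Real.log (1 + a) / 2)) = (Real.sqrt (1 + a))⁻¹ := by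
    rw [Real.exp_neg, Real.sqrt_eq_rpow, Real.rpow_def_of_pos h1a]
    congr 2; ring
  have key : ∀ ξ : ℝ, gaussianPDF 0 1 ξ *
      ENNReal.ofReal (Real.exp ((μ + R * Real.sqrt a * ξ) / R ^ 2 * e -
        ((μ + R * Real.sqrt a * ξ) / R ^ 2) ^ 2 * R ^ 2 / 2)) =
      ENNReal.ofReal c * ENNReal.ofReal (gaussianPDFReal b v ξ) := by
    intro ξ
    rw [gaussianPDF, ← ENNReal.ofReal_mul (gaussianPDFReal_nonneg _ _ _),
      ← ENNReal.ofReal_mul (Real.exp_pos _).le]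
    congr 1
    rw [gaussianPDFReal, gaussianPDFReal, sub_eq_add_neg _ (Real.log (1 + a) / 2), Real.exp_add,
      hlog]
    have hvc : (v : ℝ) = (1 + a)⁻¹ := rfl
    have hs : Real.sqrt (2 * Real.pi * v) = Real.sqrt (2 * Real.pi) * (Real.sqrt (1 + a))⁻¹ := by
      rw [hvc, Real.sqrt_mul (by positivity), Real.sqrt_inv]
    have hs1 : Real.sqrt (1 + a) ≠ 0 := (Real.sqrt_pos.mpr h1a).ne'
    rw [hs, hvc, NNReal.coe_one, mul_one, mul_inv, inv_inv]
    have hexp : Real.exp (-(ξ - 0) ^ 2 / (2 * 1)) *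
        Real.exp ((μ + R * Real.sqrt a * ξ) / R ^ 2 * e -
          ((μ + R * Real.sqrt a * ξ) / R ^ 2) ^ 2 * R ^ 2 / 2) =
        Real.exp ((e ^ 2 - (e - μ) ^ 2 / (1 + a)) / (2 * R ^ 2)) *
          Real.exp (-(ξ - b) ^ 2 / (2 * (1 + a)⁻¹)) := by
      rw [← Real.exp_add, ← Real.exp_add]
      congr 1
      rw [hb]
      field_simp
      ring_nf
      simp only [hsq]
      ring
    rw [mul_assoc, hexp]
    field_simp
  rw [gaussianReal_of_var_ne_zero 0 one_ne_zero,
    lintegral_withDensity_eq_lintegral_mul _ (measurable_gaussianPDF _ _) (by fun_prop)]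
  simp only [Pi.mul_apply, key]
  rw [lintegral_const_mul _ (measurable_gaussianPDFReal _ _).ennreal_ofReal,
    lintegral_gaussianPDFReal_eq_one _ hv0, mul_one]

end SubGaussian

/-! ### Measurability of posterior quantities -/

section Measurability

open Matrix

variable {α X ι : Type*} {_ : MeasurableSpace α} [MeasurableSpace X] [Fintype ι]

theorem measurable_dotProduct {u v : α → ι → ℝ} (hu : ∀ i, Measurable fun w => u w i)
    (hv : ∀ i, Measurable fun w => v w i) : Measurable fun w => u w ⬝ᵥ v w := by
  simp only [dotProduct]
  exact Finset.measurable_sum _ fun i _ => (hu i).mul (hv i)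

theorem measurable_det [DecidableEq ι] {A : α → Matrix ι ι ℝ} (hA : ∀ i j, Measurable fun w => A w i j) :
    Measurable fun w => (A w).det := by
  simp only [det_apply]
  refine Finset.measurable_sum _ fun σ _ => ?_
  exact (Finset.measurable_prod _ fun i _ => hA _ _).const_smul _

theorem measurable_inv_apply [DecidableEq ι] {A : α → Matrix ι ι ℝ} (hA : ∀ i j, Measurable fun w => A w i j)
    (i j : ι) : Measurable fun w => (A w)⁻¹ i j := by
  simp only [inv_def, Ring.inverse_eq_inv', Matrix.smul_apply, smul_eq_mul, adjugate_apply]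
  refine (measurable_det hA).inv.mul (measurable_det fun a b => ?_)
  simp only [updateRow_apply]
  split_ifs
  · exact measurable_const
  · exact hA _ _

variable {k : X → X → ℝ} {lam : ℝ} {t : ℕ}

theorem measurable_regMatrix (hk : Measurable fun p : X × X => k p.1 p.2) {x : α → Fin t → X}
    (hx : ∀ i, Measurable fun w => x w i) (i j : Fin t) :
    Measurable fun w => regMatrix k lam (x w) i j := by
  simp only [regMatrix, kernelMatrix, Matrix.add_apply, of_apply]
  exact (hk.comp ((hx i).prodMk (hx j))).add_const _

theorem measurable_infoGain (hk : Measurable fun p : X × X => k p.1 p.2) {x : α → Fin t → X}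
    (hx : ∀ i, Measurable fun w => x w i) : Measurable fun w => infoGain k lam (x w) := by
  unfold infoGain
  exact (Real.measurable_log.comp
    ((measurable_det (measurable_regMatrix hk hx)).div_const _)).div_const _

theorem measurable_bilin_inv (hk : Measurable fun p : X × X => k p.1 p.2) {x : α → Fin t → X}
    (hx : ∀ i, Measurable fun w => x w i) {u v : α → Fin t → ℝ}
    (hu : ∀ i, Measurable fun w => u w i) (hv : ∀ i, Measurable fun w => v w i) :
    Measurable fun w => u w ⬝ᵥ ((regMatrix k lam (x w))⁻¹ *ᵥ v w) :=
  measurable_dotProduct hu fun i =>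
    measurable_dotProduct (measurable_inv_apply (measurable_regMatrix hk hx) i) hv

theorem measurable_noiseForm (hk : Measurable fun p : X × X => k p.1 p.2) {x : α → Fin t → X}
    (hx : ∀ i, Measurable fun w => x w i) {v : α → Fin t → ℝ}
    (hv : ∀ i, Measurable fun w => v w i) :
    Measurable fun w => noiseForm k lam (x w) (v w) :=
  (measurable_dotProduct hv hv).sub ((measurable_bilin_inv hk hx hv hv).const_mul lam)

theorem measurable_postMean (hk : Measurable fun p : X × X => k p.1 p.2) {x : α → Fin t → X}
    (hx : ∀ i, Measurable fun w => x w i) {v : α → Fin t → ℝ}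
    (hv : ∀ i, Measurable fun w => v w i) {z : α → X} (hz : Measurable z) :
    Measurable fun w => postMean k lam (x w) (v w) (z w) :=
  measurable_bilin_inv hk hx (fun i => hk.comp (hz.prodMk (hx i))) hv

theorem measurable_postVar (hk : Measurable fun p : X × X => k p.1 p.2) {x : α → Fin t → X}
    (hx : ∀ i, Measurable fun w => x w i) {z : α → X} (hz : Measurable z) :
    Measurable fun w => postVar k lam (x w) (z w) :=
  (hk.comp (hz.prodMk hz)).sub (measurable_bilin_inv hk hx
    (fun i => hk.comp (hz.prodMk (hx i))) fun i => hk.comp (hz.prodMk (hx i)))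

end Measurability

/-! ### Self-normalized confidence bound for the noise -/

section Confidence

variable {Ω X H : Type*} [NormedAddCommGroup H] [InnerProductSpace ℝ H] {k : X → X → ℝ} {φ : X → H}
  {lam R : ℝ}

/-- The noise of the first `t` rounds. -/
def noise (ε : ℕ → Ω → ℝ) (t : ℕ) (w : Ω) : Fin t → ℝ := fun i => ε i w

/-- The self-normalized exponential supermartingale of the noise. -/
noncomputable def selfNormalized (k : X → X → ℝ) (lam R : ℝ) (x : ℕ → Ω → X) (ε : ℕ → Ω → ℝ)
    (t : ℕ) (w : Ω) : ENNReal :=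
  ENNReal.ofReal (Real.exp (noiseForm k lam (pts x t w) (noise ε t w) / (2 * R ^ 2) -
    infoGain k lam (pts x t w)))

/-- The mixture is the one that predicts the noise by its own posterior: mean `postMean` of the past
noise and variance `R² postVar / λ`. Its closed form, with `a = postVar / λ`, is exactly the
increment of `noiseForm` and `infoGain`. -/
theorem selfNormalized_succ (hk : ∀ x z, k x z = inner ℝ (φ x) (φ z)) (hlam : 0 < lam)
    (hR : 0 < R) (x : ℕ → Ω → X) (ε : ℕ → Ω → ℝ) (t : ℕ) (w : Ω) :
    selfNormalized k lam R x ε (t + 1) w = selfNormalized k lam R x ε t w *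
      ∫⁻ ξ, ENNReal.ofReal (Real.exp (
        (postMean k lam (pts x t w) (noise ε t w) (x t w) +
          R * Real.sqrt (postVar k lam (pts x t w) (x t w) / lam) * ξ) / R ^ 2 * ε t w -
        ((postMean k lam (pts x t w) (noise ε t w) (x t w) +
          R * Real.sqrt (postVar k lam (pts x t w) (x t w) / lam) * ξ) / R ^ 2) ^ 2 * R ^ 2 / 2))
        ∂(gaussianReal 0 1) := by
  have hpos := postVar_nonneg hk hlam (pts x t w) (x t w)
  rw [lintegral_exp_gaussian_mixture hR (div_nonneg hpos hlam.le), selfNormalized, selfNormalized,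
    ← ENNReal.ofReal_mul (Real.exp_pos _).le, ← Real.exp_add,
    noiseForm_succ (pts x (t + 1) w) hk hlam, infoGain_succ (pts x (t + 1) w) hk hlam]
  change ENNReal.ofReal (Real.exp ((noiseForm k lam (pts x t w) (noise ε t w) + (ε t w ^ 2 - lam *
      ((ε t w - postMean k lam (pts x t w) (noise ε t w) (x t w)) ^ 2 /
        (lam + postVar k lam (pts x t w) (x t w))))) / (2 * R ^ 2) -
    (infoGain k lam (pts x t w) +
      Real.log (1 + postVar k lam (pts x t w) (x t w) / lam) / 2))) = _
  congr 2
  have h1 : lam + postVar k lam (pts x t w) (x t w) ≠ 0 := by positivity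
  have h2 : ∀ b : ℝ, b / (1 + postVar k lam (pts x t w) (x t w) / lam) =
      lam * (b / (lam + postVar k lam (pts x t w) (x t w))) := by
    intro b; field_simp
  rw [h2]
  ring

variable [MeasurableSpace X] [mΩ : MeasurableSpace Ω] {P : Measure Ω}
  {ℱ : Filtration ℕ mΩ} {T : ℕ} {ε : ℕ → Ω → ℝ} {x : ℕ → Ω → X}

theorem measurable_selfNormalized (hkm : Measurable fun p : X × X => k p.1 p.2)
    (hε : CondSubGaussianNoise P ℱ R T ε) (hx : ∀ t < T, Measurable[ℱ t] (x t)) {t : ℕ}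
    (ht : t ≤ T) : Measurable[ℱ t] (selfNormalized k lam R x ε t) := by
  have hp : ∀ i : Fin t, Measurable[ℱ t] fun w => pts x t w i := fun i =>
    (hx i (i.2.trans_le ht)).mono (ℱ.mono i.2.le) le_rfl
  have hn : ∀ i : Fin t, Measurable[ℱ t] fun w => noise ε t w i := fun i =>
    (hε.adapted i (i.2.trans_le ht)).mono (ℱ.mono i.2) le_rfl
  exact ENNReal.measurable_ofReal.comp (Real.measurable_exp.comp
    (((measurable_noiseForm hkm hp hn).div_const _).sub (measurable_infoGain hkm hp)))

theorem setLIntegral_selfNormalized_succ_le [IsProbabilityMeasure P]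
    (hk : ∀ x z, k x z = inner ℝ (φ x) (φ z))
    (hlam : 0 < lam) (hR : 0 < R) (hkm : Measurable fun p : X × X => k p.1 p.2)
    (hε : CondSubGaussianNoise P ℱ R T ε) (hx : ∀ t < T, Measurable[ℱ t] (x t)) {t : ℕ}
    (ht : t < T) {A : Set Ω} (hA : MeasurableSet[ℱ t] A) :
    ∫⁻ w in A, selfNormalized k lam R x ε (t + 1) w ∂P ≤
      ∫⁻ w in A, selfNormalized k lam R x ε t w ∂P := by
  have hp : ∀ i : Fin t, Measurable[ℱ t] fun w => pts x t w i := fun i =>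
    (hx i (i.2.trans ht)).mono (ℱ.mono i.2.le) le_rfl
  have hn : ∀ i : Fin t, Measurable[ℱ t] fun w => noise ε t w i := fun i =>
    (hε.adapted i (i.2.trans ht)).mono (ℱ.mono i.2) le_rfl
  have he : Measurable (ε t) := (hε.adapted t ht).mono (ℱ.le _) le_rfl
  set g₀ : Ω → ℝ := fun w => postMean k lam (pts x t w) (noise ε t w) (x t w) with hg₀
  set g₁ : Ω → ℝ := fun w => R * Real.sqrt (postVar k lam (pts x t w) (x t w) / lam) with hg₁
  have hg₀m : Measurable[ℱ t] g₀ := measurable_postMean hkm hp hn (hx t ht)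
  have hg₁m : Measurable[ℱ t] g₁ :=
    (((measurable_postVar hkm hp (hx t ht)).div_const _).sqrt).const_mul R
  have hg₀m' : Measurable g₀ := hg₀m.mono (ℱ.le t) le_rfl
  have hg₁m' : Measurable g₁ := hg₁m.mono (ℱ.le t) le_rfl
  set W : Ω → ENNReal := A.indicator (selfNormalized k lam R x ε t) with hW
  have hWm : Measurable[ℱ t] W := (measurable_selfNormalized hkm hε hx ht.le).indicator hA
  have hWm' : Measurable W := hWm.mono (ℱ.le t) le_rfl
  rw [← lintegral_indicator (ℱ.le t _ hA), ← lintegral_indicator (ℱ.le t _ hA)]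
  calc ∫⁻ w, A.indicator (selfNormalized k lam R x ε (t + 1)) w ∂P
      = ∫⁻ w, ∫⁻ ξ, W w * ENNReal.ofReal (Real.exp ((g₀ w + g₁ w * ξ) / R ^ 2 * ε t w -
          ((g₀ w + g₁ w * ξ) / R ^ 2) ^ 2 * R ^ 2 / 2)) ∂(gaussianReal 0 1) ∂P := by
        refine lintegral_congr fun w => ?_
        rw [lintegral_const_mul _ (by fun_prop)]
        by_cases hw : w ∈ A
        · rw [hW, Set.indicator_of_mem hw, Set.indicator_of_mem hw,
            selfNormalized_succ hk hlam hR]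
        · rw [hW, Set.indicator_of_notMem hw, Set.indicator_of_notMem hw, zero_mul]
    -- For fixed `ξ` the multiplier of `ε t` is `ℱ t`-measurable, so after Tonelli the sub-Gaussian
    -- bound applies to each `ξ`.
    _ = ∫⁻ ξ, ∫⁻ w, W w * ENNReal.ofReal (Real.exp ((g₀ w + g₁ w * ξ) / R ^ 2 * ε t w -
          ((g₀ w + g₁ w * ξ) / R ^ 2) ^ 2 * R ^ 2 / 2)) ∂P ∂(gaussianReal 0 1) := by
        refine lintegral_lintegral_swap (Measurable.aemeasurable ?_)
        simp only [Function.uncurry_def]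
        fun_prop
    _ ≤ ∫⁻ _, ∫⁻ w, W w ∂P ∂(gaussianReal 0 1) := by
        refine lintegral_mono fun ξ => ?_
        exact lintegral_mul_exp_le (ℱ.le t) he (hε.integrable t ht) (hε.condExp_le t ht) hWm
          ((hg₀m.add (hg₁m.mul_const ξ)).div_const (R ^ 2))
    _ = ∫⁻ w, W w ∂P := by simp

/-- With probability at least `1 - δ` the self-normalized noise is controlled by the information
gain, simultaneously in all rounds. -/
theorem measure_noiseForm_le [IsProbabilityMeasure P] (hk : ∀ x z, k x z = inner ℝ (φ x) (φ z))
    (hlam : 0 < lam) (hR : 0 < R) (hkm : Measurable fun p : X × X => k p.1 p.2)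
    (hε : CondSubGaussianNoise P ℱ R T ε) (hx : ∀ t < T, Measurable[ℱ t] (x t)) {δ : ℝ}
    (hδ : 0 < δ) :
    ENNReal.ofReal (1 - δ) ≤ P {w | ∀ t ≤ T, noiseForm k lam (pts x t w) (noise ε t w) ≤
      2 * R ^ 2 * (infoGain k lam (pts x t w) + Real.log (1 / δ))} := by
  have hville := measure_exists_le_of_supermartingale (P := P) (c := ENNReal.ofReal (1 / δ))
    (M := selfNormalized k lam R x ε) (ℱ := ℱ) (T := T)
    (fun t ht => measurable_selfNormalized hkm hε hx ht)
    (by simp [selfNormalized, noiseForm, infoGain_zero])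
    (fun t ht A hA => setLIntegral_selfNormalized_succ_le hk hlam hR hkm hε hx ht hA)
  set S := {w | ∃ t ≤ T, ENNReal.ofReal (1 / δ) ≤ selfNormalized k lam R x ε t w} with hS
  have hPS : P S ≤ ENNReal.ofReal δ := by
    have h1 : ENNReal.ofReal δ * (ENNReal.ofReal (1 / δ) * P S) ≤ ENNReal.ofReal δ * 1 := by gcongr
    rwa [← mul_assoc, ← ENNReal.ofReal_mul hδ.le, mul_one_div_cancel hδ.ne', ENNReal.ofReal_one,
      one_mul, mul_one] at h1
  have hcompl : ENNReal.ofReal (1 - δ) ≤ P Sᶜ := by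
    have h1 : 1 ≤ P S + P Sᶜ := by
      rw [← measure_univ (μ := P), ← Set.union_compl_self S]
      exact measure_union_le _ _
    rw [ENNReal.ofReal_sub _ hδ.le, ENNReal.ofReal_one]
    exact tsub_le_iff_left.mpr (h1.trans (by gcongr))
  refine hcompl.trans (measure_mono fun w hw t ht => ?_)
  by_contra hcon
  refine hw ⟨t, ht, ENNReal.ofReal_le_ofReal ?_⟩
  rw [← Real.exp_log (show 0 < 1 / δ by positivity)]
  refine Real.exp_le_exp.mpr ?_
  rw [le_sub_iff_add_le, le_div_iff₀ (by positivity)]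
  linarith [not_le.mp hcon]

end Confidence

/-! ### The expected improvement function -/

section ExpectedImprovement

/-- The expected positive part `𝔼 (s - Z)⁺` of a shifted standard normal variable. -/
noncomputable def expPosPart (s : ℝ) : ℝ := ∫ z, max (s - z) 0 ∂(gaussianReal 0 1)

theorem integrable_id_stdNormal : Integrable (fun z : ℝ => z) (gaussianReal 0 1) :=
  (memLp_id_gaussianReal' 1 ENNReal.one_ne_top).integrable le_rfl

theorem integrable_posPart_stdNormal (s : ℝ) :
    Integrable (fun z : ℝ => max (s - z) 0) (gaussianReal 0 1) :=
  ((integrable_const s).sub integrable_id_stdNormal).pos_part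

theorem expPosPart_mono : Monotone expPosPart := fun s t h =>
  integral_mono (integrable_posPart_stdNormal s) (integrable_posPart_stdNormal t) fun z =>
    max_le_max_right 0 (sub_le_sub_right h z)

theorem expPosPart_nonneg (s : ℝ) : 0 ≤ expPosPart s :=
  integral_nonneg fun _ => le_max_right _ _

theorem le_expPosPart (s : ℝ) : s ≤ expPosPart s := by
  have h1 : ∫ z, (s - z) ∂(gaussianReal 0 1) = s := by
    rw [integral_sub (integrable_const s) integrable_id_stdNormal, integral_id_gaussianReal]
    simp
  calc s = ∫ z, (s - z) ∂(gaussianReal 0 1) := h1.symm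
    _ ≤ _ := integral_mono ((integrable_const s).sub integrable_id_stdNormal)
      (integrable_posPart_stdNormal s) fun z => le_max_left _ _

theorem expPosPart_pos (s : ℝ) : 0 < expPosPart s := by
  have h0 : (0 : ℝ → ℝ) ≤ fun z => max (s - z) 0 := fun _ => le_max_right _ _
  rw [expPosPart, integral_pos_iff_support_of_nonneg h0 (integrable_posPart_stdNormal s),
    pos_iff_ne_zero]
  intro h
  have h1 := gaussianReal_absolutelyContinuous' 0 (one_ne_zero) h
  have h2 : Set.Iio s ⊆ Function.support fun z : ℝ => max (s - z) 0 := fun z hz => by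
    have : 0 < s - z := sub_pos.mpr hz
    simp [max_eq_left this.le, this.ne']
  have h3 := measure_mono_null h2 h1
  simp at h3

theorem hasDerivAt_stdNormalPDF (z : ℝ) :
    HasDerivAt (gaussianPDFReal 0 1) (-(z * gaussianPDFReal 0 1 z)) z := by
  have h1 : HasDerivAt (fun z : ℝ => -(z - 0) ^ 2 / (2 * ((1 : NNReal) : ℝ))) (-z) z := by
    have := (((hasDerivAt_id z).sub_const 0).pow 2).neg.div_const (2 * ((1 : NNReal) : ℝ))
    refine this.congr_deriv ?_
    simp
    ring
  have h2 := h1.exp.const_mul (Real.sqrt (2 * Real.pi * ((1 : NNReal) : ℝ)))⁻¹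
  refine h2.congr_deriv ?_
  simp only [gaussianPDFReal]
  ring

theorem tendsto_stdNormalPDF_atBot :
    Filter.Tendsto (gaussianPDFReal 0 1) Filter.atBot (nhds 0) := by
  have h1 : Filter.Tendsto (fun z : ℝ => -(z - 0) ^ 2 / (2 * ((1 : NNReal) : ℝ))) Filter.atBot
      Filter.atBot := by
    simp only [sub_zero, NNReal.coe_one, mul_one]
    refine Filter.Tendsto.atBot_div_const (by norm_num) (Filter.tendsto_neg_atTop_atBot.comp ?_)
    exact (Filter.tendsto_pow_atTop two_ne_zero).comp Filter.tendsto_abs_atBot_atTop |>.congr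
      fun z => sq_abs z
  have h2 := (Real.tendsto_exp_atBot.comp h1).const_mul
    (Real.sqrt (2 * Real.pi * ((1 : NNReal) : ℝ)))⁻¹
  rw [mul_zero] at h2
  exact h2

/-- Integrate `s - z` against the normal density over `z ≤ s`; the linear term is exact because `-z
φ(z)` is the derivative of `φ`. -/
theorem expPosPart_eq (s : ℝ) :
    expPosPart s = s * cdf (gaussianReal 0 1) s + gaussianPDFReal 0 1 s := by
  have hzint : Integrable (fun z : ℝ => -(z * gaussianPDFReal 0 1 z)) := by
    have h := integrable_id_stdNormal
    rw [gaussianReal_of_var_ne_zero 0 one_ne_zero, integrable_withDensity_iff_integrable_smul'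
      (measurable_gaussianPDF _ _) (Filter.Eventually.of_forall fun _ => gaussianPDF_lt_top)] at h
    refine h.neg.congr (Filter.Eventually.of_forall fun z => ?_)
    simp [toReal_gaussianPDF, mul_comm]
  have h1 : ∫ z in Set.Iic s, -(z * gaussianPDFReal 0 1 z) = gaussianPDFReal 0 1 s := by
    rw [integral_Iic_of_hasDerivAt_of_tendsto' (fun z _ => hasDerivAt_stdNormalPDF z)
      hzint.integrableOn tendsto_stdNormalPDF_atBot, sub_zero]
  have h2 : ∫ z in Set.Iic s, gaussianPDFReal 0 1 z = cdf (gaussianReal 0 1) s := by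
    rw [cdf_eq_real, measureReal_def, gaussianReal_apply_eq_integral 0 one_ne_zero,
      ENNReal.toReal_ofReal]
    exact setIntegral_nonneg measurableSet_Iic fun z _ => gaussianPDFReal_nonneg _ _ _
  rw [expPosPart, integral_gaussianReal_eq_integral_smul one_ne_zero, ← h1, ← h2,
    ← integral_const_mul, ← integral_add ((integrable_gaussianPDFReal 0 1).integrableOn.const_mul s)
      hzint.integrableOn, ← integral_indicator measurableSet_Iic]
  congr 1
  ext z
  by_cases hz : z ≤ s
  · rw [Set.indicator_of_mem (Set.mem_Iic.mpr hz), max_eq_left (sub_nonneg.mpr hz), smul_eq_mul]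
    ring
  · rw [Set.indicator_of_notMem (fun h => hz (Set.mem_Iic.mp h)),
      max_eq_right (sub_nonpos.mpr (not_le.mp hz).le), smul_zero]

theorem rho_of_pos {v : ℝ} (hv : 0 < v) (u : ℝ) : rho u v = v * expPosPart (u / v) := by
  rw [rho, if_pos hv, expPosPart_eq]
  field_simp

theorem rho_zero_right (u : ℝ) : rho u 0 = max 0 u := by simp [rho]

theorem rho_nonneg {v : ℝ} (hv : 0 ≤ v) (u : ℝ) : 0 ≤ rho u v := by
  rcases hv.eq_or_lt with rfl | hv
  · rw [rho_zero_right]; exact le_max_left _ _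
  · rw [rho_of_pos hv]; exact mul_nonneg hv.le (expPosPart_nonneg _)

theorem stdNormalPDF_le (s : ℝ) : gaussianPDFReal 0 1 s ≤ gaussianPDFReal 0 1 0 := by
  simp only [gaussianPDFReal]
  refine mul_le_mul_of_nonneg_left (Real.exp_le_exp.mpr ?_) (by positivity)
  have := sq_nonneg s
  norm_num
  linarith

theorem stdNormalPDF_zero_le_one : gaussianPDFReal 0 1 0 ≤ 1 := by
  simp only [gaussianPDFReal]
  have h : 1 ≤ Real.sqrt (2 * Real.pi) := by
    rw [Real.one_le_sqrt]; nlinarith [Real.pi_gt_three]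
  simpa using inv_le_one_of_one_le₀ h

/-- The acquisition value is at most the positive part of the mean improvement plus the
exploration term. -/
theorem rho_le {v : ℝ} (hv : 0 ≤ v) (u : ℝ) :
    rho u v ≤ max 0 u + v * gaussianPDFReal 0 1 0 := by
  rcases hv.eq_or_lt with rfl | hv
  · rw [rho_zero_right]; simp
  · rw [rho, if_pos hv]
    have h1 : u * cdf (gaussianReal 0 1) (u / v) ≤ max 0 u := by
      have h0 := cdf_nonneg (gaussianReal 0 1) (u / v)
      have h1 := cdf_le_one (gaussianReal 0 1) (u / v)
      rcases le_total 0 u with hu | hu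
      · rw [max_eq_right hu]; nlinarith
      · rw [max_eq_left hu]; nlinarith
    have h2 := mul_le_mul_of_nonneg_left (stdNormalPDF_le (u / v)) hv.le
    linarith

theorem rho_zero_left {v : ℝ} (hv : 0 ≤ v) : rho 0 v = v * gaussianPDFReal 0 1 0 := by
  rcases hv.eq_or_lt with rfl | hv
  · simp [rho_zero_right]
  · simp [rho, if_pos hv]

/-- An optimistic improvement is at most a constant multiple of the expected improvement. -/
theorem add_mul_le_rho {c v : ℝ} (hc : 0 ≤ c) (hv : 0 ≤ v) (u : ℝ) :
    u + c * v ≤ (1 + c / expPosPart (-c)) * rho u v := by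
  have hτ := expPosPart_pos (-c)
  have hK : 0 ≤ c / expPosPart (-c) := div_nonneg hc hτ.le
  have hρ := rho_nonneg hv u
  rcases hv.eq_or_lt with rfl | hv
  · rw [rho_zero_right] at *
    nlinarith [le_max_right 0 u]
  · rcases lt_or_ge (u + c * v) 0 with h | h
    · exact h.le.trans (mul_nonneg (by linarith) hρ)
    -- If the optimistic value is nonnegative, monotonicity gives `rho u v ≥ v * expPosPart (-c)`,
    -- which pays for `c * v`; the bound `u ≤ rho u v` pays for `u`.
    · have h1 : -c ≤ u / v := by rw [le_div_iff₀ hv]; linarith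
      have h2 := expPosPart_mono h1
      have h3 : u ≤ rho u v := by
        rw [rho_of_pos hv]
        calc u = v * (u / v) := by field_simp
          _ ≤ _ := mul_le_mul_of_nonneg_left (le_expPosPart _) hv.le
      have h4 : c * v ≤ c / expPosPart (-c) * rho u v := by
        rw [rho_of_pos hv]
        calc c * v = c / expPosPart (-c) * (v * expPosPart (-c)) := by field_simp
          _ ≤ _ := by gcongr
      linarith

end ExpectedImprovement

/-! ### Deterministic regret analysis -/

section Regret

variable {X : Type*} {f : X → ℝ} {μ σ : ℕ → X → ℝ} {m ω : ℕ → ℝ} {x xr : ℕ → X} {c : ℝ} {n : ℕ}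

/-- Deterministic analysis of one round of the algorithm on the event that the confidence bounds
hold: the instantaneous regret is controlled by the improvement of the posterior mean over the
incumbent and by the posterior standard deviation at the sampled point. -/
theorem round_regret_le {μt σt : X → ℝ} {mt ωt : ℝ} {t : ℕ} (hc : 0 ≤ c) (hω : 0 < ωt)
    (hσ : ∀ z, 0 ≤ σt z) (hconf : ∀ z, |f z - μt z| ≤ c * ωt * σt z)
    (hm0 : t = 0 → mt = 0 ∧ ∀ z, μt z = 0) (hmle : ∀ i < t, μt (x i) ≤ mt)
    (hmeq : t ≠ 0 → ∃ i < t, mt = μt (x i))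
    (hacq : ∀ z, rho (μt z - mt) (ωt * σt z) ≤ rho (μt (x t) - mt) (ωt * σt (x t)))
    {y : X} (hrep : ∃ i ≤ t, y = x i ∧ ∀ j ≤ t, μt (x j) ≤ μt (x i)) (z : X) :
    f z - f y ≤ (1 + c / expPosPart (-c)) * (max 0 (μt (x t) - mt) + ωt * σt (x t)) +
      c * ωt * σt (x t) := by
  set K := 1 + c / expPosPart (-c) with hK
  have hK1 : 0 ≤ K := by
    have := div_nonneg hc (expPosPart_pos (-c)).le
    linarith
  have hφ : 0 < gaussianPDFReal 0 1 0 := gaussianPDFReal_pos 0 1 0 one_ne_zero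
  have hvt : 0 ≤ ωt * σt (x t) := mul_nonneg hω.le (hσ _)
  have h1 : f z - mt ≤ K * (max 0 (μt (x t) - mt) + ωt * σt (x t)) := by
    have h2 := (abs_le.mp (hconf z)).2
    have h3 := add_mul_le_rho hc (mul_nonneg hω.le (hσ z)) (μt z - mt)
    have h4 := mul_le_mul_of_nonneg_left ((hacq z).trans (rho_le hvt _)) hK1
    have h5 : ωt * σt (x t) * gaussianPDFReal 0 1 0 ≤ ωt * σt (x t) :=
      mul_le_of_le_one_right hvt stdNormalPDF_zero_le_one
    have h6 := mul_le_mul_of_nonneg_left h5 hK1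
    rw [mul_add] at h4 ⊢
    linarith
  obtain ⟨i, hi, rfl, hmax⟩ := hrep
  have h2 : mt ≤ μt (x i) := by
    rcases eq_or_ne t 0 with h0 | h0
    · rw [(hm0 h0).1, (hm0 h0).2]
    · obtain ⟨j, hj, hj'⟩ := hmeq h0
      rw [hj']; exact hmax j hj.le
  -- A reported earlier point attains the incumbent, so its acquisition is `ωt * σt (x i) * φ(0)`.
  -- The new point then has no positive mean improvement, so its acquisition is at most `ωt * σt (x
  -- t) * φ(0)`; maximality compares the deviations.
  have h3 : σt (x i) ≤ σt (x t) := by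
    rcases hi.eq_or_lt with rfl | hlt
    · exact le_rfl
    · have hmt : μt (x i) = mt := le_antisymm (hmle i hlt) h2
      have h4 := (hacq (x i)).trans (rho_le hvt _)
      rw [hmt, sub_self, rho_zero_left (mul_nonneg hω.le (hσ _)),
        max_eq_left (by rw [← hmt]; linarith [hmax t le_rfl]), zero_add] at h4
      exact le_of_mul_le_mul_left (le_of_mul_le_mul_right h4 hφ) hω
  have h4 := (abs_le.mp (hconf (x i))).1
  have h5 : c * ωt * σt (x i) ≤ c * ωt * σt (x t) :=
    mul_le_mul_of_nonneg_left h3 (mul_nonneg hc hω.le)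
  linarith

/-- The incumbent grows with the improvement of the posterior mean, up to the confidence width. -/
theorem incumbent_add_le {b : ℝ} {t : ℕ} (hb : 0 ≤ b) (hω : 0 < ω t) (hσ : ∀ z, 0 ≤ σ t z)
    (hσmono : ∀ z, σ (t + 1) z ≤ σ t z)
    (hconf : ∀ z, |f z - μ t z| ≤ b * σ t z) (hconf' : ∀ z, |f z - μ (t + 1) z| ≤ b * σ (t + 1) z)
    (hm0 : t = 0 → m t = 0 ∧ ∀ z, μ t z = 0)
    (hmeq : t ≠ 0 → ∃ i < t, m t = μ t (x i))
    (hmle : ∀ i < t + 1, μ (t + 1) (x i) ≤ m (t + 1))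
    (hacq : ∀ z, rho (μ t z - m t) (ω t * σ t z) ≤ rho (μ t (x t) - m t) (ω t * σ t (x t))) :
    m t + max 0 (μ t (x t) - m t) - 2 * b * σ t (x t) ≤ m (t + 1) := by
  have hφ : 0 < gaussianPDFReal 0 1 0 := gaussianPDFReal_pos 0 1 0 one_ne_zero
  -- Consecutive means are both close to `f`, so they differ by at most two confidence widths.
  have hkey : ∀ y, σ t y ≤ σ t (x t) → μ t y - 2 * b * σ t (x t) ≤ μ (t + 1) y := by
    intro y hy
    have h1 := (abs_le.mp (hconf y)).1
    have h2 := (abs_le.mp (hconf' y)).2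
    have h3 := mul_le_mul_of_nonneg_left hy hb
    have h4 := mul_le_mul_of_nonneg_left (hσmono y) hb
    linarith
  rcases le_total (m t) (μ t (x t)) with h | h
  · rw [max_eq_right (sub_nonneg.mpr h)]
    linarith [hkey (x t) le_rfl, hmle t (Nat.lt_succ_self t)]
  · rw [max_eq_left (sub_nonpos.mpr h)]
    rcases eq_or_ne t 0 with h0 | h0
    · have h1 := hkey (x t) le_rfl
      rw [(hm0 h0).2] at h1
      rw [(hm0 h0).1]
      linarith [hmle t (Nat.lt_succ_self t)]
    · obtain ⟨i, hi, hi'⟩ := hmeq h0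
      -- The old incumbent has zero improvement; as `x t` does not improve on it, maximality forces
      -- a larger deviation at `x t`, and `hkey` applies to the incumbent.
      have h4 := (hacq (x i)).trans (rho_le (mul_nonneg hω.le (hσ _)) _)
      rw [← hi', sub_self, rho_zero_left (mul_nonneg hω.le (hσ _)),
        max_eq_left (sub_nonpos.mpr h), zero_add] at h4
      have h5 := le_of_mul_le_mul_left (le_of_mul_le_mul_right h4 hφ) hω
      linarith [hkey (x i) h5, hmle i (hi.trans (Nat.lt_succ_self t))]

/-- Deterministic regret bound on the event that the confidence bounds hold. -/
theorem sum_regret_le [Nonempty X] {B s ωmax : ℝ} (hB : 0 ≤ B) (hc : 0 ≤ c) (hs : 0 ≤ s)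
    (hn : 1 ≤ n)
    (hω : ∀ t < n, 0 < ω t) (hωmax : ∀ t < n, ω t ≤ ωmax)
    (hσ : ∀ t z, 0 ≤ σ t z) (hσmono : ∀ t z, σ (t + 1) z ≤ σ t z) (hσs : ∀ t z, σ t z ≤ s)
    (hf : ∀ z, |f z| ≤ B * s)
    (hconf : ∀ t < n, ∀ z, |f z - μ t z| ≤ c * ω t * σ t z)
    (hm0 : m 0 = 0) (hμ0 : ∀ z, μ 0 z = 0) (hmle : ∀ t, ∀ i < t, μ t (x i) ≤ m t)
    (hmeq : ∀ t, t ≠ 0 → ∃ i < t, m t = μ t (x i))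
    (hacq : ∀ t < n, ∀ z, rho (μ t z - m t) (ω t * σ t z) ≤
      rho (μ t (x t) - m t) (ω t * σ t (x t)))
    (hrep : ∀ t < n, ∃ i ≤ t, xr t = x i ∧ ∀ j ≤ t, μ t (x j) ≤ μ t (x i))
    (hsum : ∑ t ∈ Finset.range n, σ t (x t) ^ 2 ≤ s ^ 2) :
    ∑ t ∈ Finset.range n, ((⨆ z, f z) - f (xr t)) ≤
      ((1 + c / expPosPart (-c)) * (B + (3 * c + 1) * ωmax) + c * ωmax) * (Real.sqrt n * s) := by
  set K := 1 + c / expPosPart (-c) with hK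
  have hK1 : 0 ≤ K := by
    have := div_nonneg hc (expPosPart_pos (-c)).le
    linarith
  have hωmax0 : 0 ≤ ωmax := (hω 0 hn).le.trans (hωmax 0 hn)
  set b := c * ωmax with hb
  have hb0 : 0 ≤ b := mul_nonneg hc hωmax0
  have hconf' : ∀ t < n, ∀ z, |f z - μ t z| ≤ b * σ t z := fun t ht z =>
    (hconf t ht z).trans (mul_le_mul_of_nonneg_right
      (mul_le_mul_of_nonneg_left (hωmax t ht) hc) (hσ t z))
  set u : ℕ → ℝ := fun t => max 0 (μ t (x t) - m t) with hu
  set S := ∑ t ∈ Finset.range n, σ t (x t) with hS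
  have hround : ∀ t ∈ Finset.range n, (⨆ z, f z) - f (xr t) ≤
      K * u t + (K * ωmax + b) * σ t (x t) := by
    intro t ht
    have ht' := Finset.mem_range.mp ht
    have h1 : ⨆ z, f z ≤ f (xr t) + (K * u t + (K * ωmax + b) * σ t (x t)) := by
      refine ciSup_le fun z => ?_
      have h2 := round_regret_le hc (hω t ht') (hσ t) (hconf t ht')
        (fun h0 => by subst h0; exact ⟨hm0, hμ0⟩) (hmle t) (hmeq t) (hacq t ht') (hrep t ht') z
      have h3 := mul_le_mul_of_nonneg_right (hωmax t ht') (hσ t (x t))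
      have h4 := mul_le_mul_of_nonneg_left h3 hK1
      have h5 := mul_le_mul_of_nonneg_left h3 hc
      rw [mul_add] at h2
      simp only [hu, hb]
      linarith
    linarith
  have htel : ∀ j < n, ∑ t ∈ Finset.range j, u t ≤
      m j + 2 * b * ∑ t ∈ Finset.range j, σ t (x t) := by
    intro j
    induction j with
    | zero => intro _; simp [hm0]
    | succ j ih =>
      intro hj
      have hj' : j < n := (Nat.lt_succ_self j).trans hj
      have h1 := ih hj'
      have h2 := incumbent_add_le (f := f) (m := m) (ω := ω) (x := x) hb0 (hω j hj') (hσ j)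
        (hσmono j) (hconf' j hj') (hconf' (j + 1) hj)
        (fun h0 => by subst h0; exact ⟨hm0, hμ0⟩) (hmeq j) (hmle (j + 1)) (hacq j hj')
      rw [Finset.sum_range_succ, Finset.sum_range_succ, mul_add]
      simp only [hu] at h1 ⊢
      linarith
  have hμle : ∀ t < n, ∀ z, μ t z ≤ (B + b) * s := by
    intro t ht z
    have h1 := (abs_le.mp (hconf' t ht z)).1
    have h2 := (abs_le.mp (hf z)).2
    have h3 := mul_le_mul_of_nonneg_left (hσs t z) hb0
    rw [add_mul]; linarith
  have husum : ∑ t ∈ Finset.range n, u t ≤ (B + b) * s + 2 * b * S := by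
    -- Telescoping stops at round `n - 1`, since the confidence bounds with `ωmax` cover only `t <
    -- n`. The last improvement is absorbed in the uniform bound on the posterior mean.
    obtain ⟨j, rfl⟩ : ∃ j, n = j + 1 := ⟨n - 1, by omega⟩
    have hj : j < j + 1 := Nat.lt_succ_self j
    have h1 := htel j hj
    have hml : m j ≤ (B + b) * s := by
      rcases eq_or_ne j 0 with h0 | h0
      · rw [h0, hm0]; positivity
      · obtain ⟨i, _, hi'⟩ := hmeq j h0
        rw [hi']; exact hμle j hj _
    have h2 : m j + u j ≤ (B + b) * s := by
      simp only [hu]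
      rcases le_total (μ j (x j) - m j) 0 with h | h
      · rw [max_eq_left h]; linarith
      · rw [max_eq_right h]; linarith [hμle j hj (x j)]
    have h3 : 0 ≤ 2 * b * σ j (x j) := mul_nonneg (by linarith) (hσ _ _)
    rw [hS, Finset.sum_range_succ, Finset.sum_range_succ, mul_add]
    linarith
  have hSle : S ≤ Real.sqrt n * s := by
    refine le_of_abs_le <| abs_le_of_sq_le_sq ?_ (by positivity)
    rw [mul_pow, Real.sq_sqrt (Nat.cast_nonneg n)]
    calc S ^ 2 ≤ (Finset.range n).card * ∑ t ∈ Finset.range n, σ t (x t) ^ 2 :=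
          sq_sum_le_card_mul_sum_sq
      _ ≤ n * s ^ 2 := by rw [Finset.card_range]; gcongr
  have hsle : s ≤ Real.sqrt n * s := by
    refine le_mul_of_one_le_left hs ?_
    rw [Real.one_le_sqrt]; exact_mod_cast hn
  calc ∑ t ∈ Finset.range n, ((⨆ z, f z) - f (xr t))
      ≤ ∑ t ∈ Finset.range n, (K * u t + (K * ωmax + b) * σ t (x t)) := Finset.sum_le_sum hround
    _ = K * ∑ t ∈ Finset.range n, u t + (K * ωmax + b) * S := by
        rw [Finset.sum_add_distrib, ← Finset.mul_sum, ← Finset.mul_sum]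
    _ ≤ K * ((B + b) * s + 2 * b * S) + (K * ωmax + b) * S := by gcongr
    _ ≤ K * ((B + b) * (Real.sqrt n * s) + 2 * b * (Real.sqrt n * s)) +
        (K * ωmax + b) * (Real.sqrt n * s) := by gcongr
    _ = _ := by rw [hb]; ring

end Regret

/-! ### Posterior variances against the information gain -/

section GainBounds

variable {X H : Type*} [NormedAddCommGroup H] [InnerProductSpace ℝ H] {k : X → X → ℝ} {φ : X → H}
  {lam : ℝ}

/-- From `log y ≥ 1 - 1 / y` at `y = 1 + a / lam`, which gives `a / (lam + a)`, and `lam + a ≤ lam₁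
+ 1`. -/
theorem le_mul_log_one_add_div {a lam₁ : ℝ} (hlam : 0 < lam) (hle : lam ≤ lam₁) (ha : 0 ≤ a)
    (ha1 : a ≤ 1) : a ≤ 2 * (1 + lam₁) * (Real.log (1 + a / lam) / 2) := by
  have h1 : 0 < 1 + a / lam := by positivity
  have h2 := Real.one_sub_inv_le_log_of_pos h1
  have h3 : 1 - (1 + a / lam)⁻¹ = a / (lam + a) := by field_simp; ring
  have h4 : a / (1 + lam₁) ≤ a / (lam + a) := 
    div_le_div_of_nonneg_left ha (by positivity) (by linarith)
  have h5 : 0 < 1 + lam₁ := by linarith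
  have h6 : a / (1 + lam₁) ≤ Real.log (1 + a / lam) := by rw [h3] at h2; exact h4.trans h2
  rw [div_le_iff₀ h5] at h6
  linarith

theorem sum_postVar_le (hk : ∀ x z, k x z = inner ℝ (φ x) (φ z)) (hlam : 0 < lam)
    (hk1 : ∀ z, k z z ≤ 1) {lam₁ : ℝ} (hle : lam ≤ lam₁) {Ω : Type*} (x : ℕ → Ω → X) (w : Ω)
    (n : ℕ) : ∑ t ∈ Finset.range n, postVar k lam (pts x t w) (x t w) ≤
      2 * (1 + lam₁) * infoGain k lam (pts x n w) := by
  induction n with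
  | zero => simp [infoGain_zero]
  | succ n ih =>
    rw [Finset.sum_range_succ, infoGain_succ (pts x (n + 1) w) hk hlam, mul_add]
    exact add_le_add ih (le_mul_log_one_add_div hlam hle (postVar_nonneg hk hlam _ _)
      ((postVar_le hk hlam _ _).trans (hk1 _)))

/-- A single observation at `z` already gains `log (1 + k z z / lam) / 2`. This is used both for the
size of `f` and for a lower bound on `γ_n`. -/
theorem kernel_diag_le_maxInfoGain (hk : ∀ x z, k x z = inner ℝ (φ x) (φ z)) (hlam : 0 < lam)
    (hk1 : ∀ z, k z z ≤ 1) {lam₁ : ℝ} (hle : lam ≤ lam₁) {n : ℕ} (hn : 1 ≤ n) (z : X) :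
    k z z ≤ 2 * (1 + lam₁) * maxInfoGain k lam n := by
  have : Nonempty X := ⟨z⟩
  have h0 : 0 ≤ k z z := by rw [hk]; exact real_inner_self_nonneg
  have h1 := le_mul_log_one_add_div hlam hle h0 (hk1 z)
  have h2 := infoGain_le_maxInfoGain hk hlam hk1 (fun _ : Fin 1 => z)
  rw [infoGain_succ _ hk hlam, infoGain_zero, zero_add] at h2
  have h3 : postVar k lam (fun _ : Fin 0 => z) z = k z z := by simp [postVar, dotProduct]
  rw [h3] at h2
  have h4 : 0 ≤ 2 * (1 + lam₁) := by linarith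
  exact h1.trans (mul_le_mul_of_nonneg_left
    (h2.trans (maxInfoGain_mono hk hlam hk1 hn)) h4)

end GainBounds

/-! ### High-probability regret of the algorithm -/

section Algorithm

variable {Ω X H : Type*} [NormedAddCommGroup H] [InnerProductSpace ℝ H] {k : X → X → ℝ} {φ : X → H}
  {lam lam₀ lam₁ B R δ : ℝ}

theorem one_le_scale (hδ : 0 < δ) (hδ1 : δ < 1) (t : ℕ) : 1 ≤ scale (X := X) k lam δ t := by
  rw [scale, Real.one_le_sqrt]
  have h1 : 0 ≤ Real.log (1 / δ) := Real.log_nonneg (by rw [le_div_iff₀ hδ]; linarith)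
  linarith [maxInfoGain_nonneg (k := k) (lam := lam) (t := t)]

theorem scale_mono [Nonempty X] (hk : ∀ x z, k x z = inner ℝ (φ x) (φ z)) (hlam : 0 < lam)
    (hk1 : ∀ z, k z z ≤ 1) : Monotone (scale (X := X) k lam δ) := fun _ _ h =>
  Real.sqrt_le_sqrt (by linarith [maxInfoGain_mono hk hlam hk1 h])

theorem beta_eq (n : ℕ) : beta (X := X) k lam δ B R n =
    B + R * (Real.sqrt 2 * scale (X := X) k lam δ (n - 1)) := by
  rw [beta, scale, Real.sqrt_mul zero_le_two]

theorem postMean_le_incumbent {t : ℕ} (x : Fin t → X) (y : Fin t → ℝ) (i : Fin t) :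
    postMean k lam x y (x i) ≤ incumbent k lam x y := by
  cases t with
  | zero => exact i.elim0
  | succ t => exact Finset.le_sup' (fun i => postMean k lam x y (x i)) (Finset.mem_univ i)

theorem exists_incumbent_eq {t : ℕ} (ht : t ≠ 0) (x : Fin t → X) (y : Fin t → ℝ) :
    ∃ i, incumbent k lam x y = postMean k lam x y (x i) := by
  cases t with
  | zero => exact absurd rfl ht
  | succ t =>
    obtain ⟨i, _, hi⟩ := Finset.exists_mem_eq_sup' Finset.univ_nonempty
      fun i : Fin (t + 1) => postMean k lam x y (x i)
    exact ⟨i, hi⟩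

/-- Confidence bounds in terms of the exploration scale of the algorithm. -/
theorem abs_sub_runMean_le (hk : ∀ x z, k x z = inner ℝ (φ x) (φ z)) (hlam₀ : 0 < lam₀)
    (hlam : lam₀ ≤ lam) (hk1 : ∀ z, k z z ≤ 1) (hR : 0 ≤ R) (hB : 0 ≤ B) (hδ : 0 < δ)
    (hδ1 : δ < 1) {f : X → ℝ} {F : H} (hf : ∀ z, f z = inner ℝ (φ z) F) (hF : ‖F‖ ≤ B)
    (x : ℕ → Ω → X) (ε : ℕ → Ω → ℝ) (t : ℕ) (w : Ω)
    (hQ : noiseForm k lam (pts x t w) (noise ε t w) ≤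
      2 * R ^ 2 * (infoGain k lam (pts x t w) + Real.log (1 / δ))) (z : X) :
    |f z - runMean k lam f x ε t w z| ≤
      (B + R * Real.sqrt (2 / lam₀)) * scale (X := X) k lam δ t *
        postStd k lam (pts x t w) z := by
  have hlam' : 0 < lam := hlam₀.trans_le hlam
  have h1 := abs_sub_postMean_le hk hlam' (pts x t w) (noise ε t w) F z
  have h2 : runMean k lam f x ε t w z =
      postMean k lam (pts x t w) (fun i => inner ℝ (φ (pts x t w i)) F + noise ε t w i) z := by
    rw [runMean]
    congr 1
    ext i
    rw [obs, hf]; rfl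
  rw [h2, hf]
  refine h1.trans (mul_le_mul_of_nonneg_right ?_ (postStd_nonneg _ _))
  -- Since the scale is at least 1, the norm bound `B` is absorbed in `B` times the scale.
  have hs := one_le_scale (k := k) (lam := lam) hδ hδ1 t
  have h3 : Real.sqrt (noiseForm k lam (pts x t w) (noise ε t w) / lam) ≤
      R * Real.sqrt (2 / lam₀) * scale (X := X) k lam δ t := by
    have hg := infoGain_le_maxInfoGain hk hlam' hk1 (pts x t w)
    have hL : 0 ≤ Real.log (1 / δ) := Real.log_nonneg (by rw [le_div_iff₀ hδ]; linarith)
    have hg0 := maxInfoGain_nonneg (k := k) (lam := lam) (t := t)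
    have h4 : noiseForm k lam (pts x t w) (noise ε t w) / lam ≤
        R ^ 2 * (2 / lam₀) * (maxInfoGain k lam t + 1 + Real.log (1 / δ)) := by
      calc noiseForm k lam (pts x t w) (noise ε t w) / lam
          ≤ 2 * R ^ 2 * (maxInfoGain k lam t + 1 + Real.log (1 / δ)) / lam := by
            gcongr
            refine hQ.trans ?_
            gcongr
            linarith
        _ ≤ 2 * R ^ 2 * (maxInfoGain k lam t + 1 + Real.log (1 / δ)) / lam₀ := by gcongr
        _ = _ := by ring
    refine (Real.sqrt_le_sqrt h4).trans (le_of_eq ?_)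
    rw [Real.sqrt_mul (by positivity), Real.sqrt_mul (by positivity), Real.sqrt_sq hR, scale]
  nlinarith

/-- Constant of the regret bound. -/
noncomputable def regretConst (B R lam₀ lam₁ : ℝ) : ℝ :=
  ((1 + (B + R * Real.sqrt (2 / lam₀)) / expPosPart (-(B + R * Real.sqrt (2 / lam₀)))) *
      (1 + (3 * (B + R * Real.sqrt (2 / lam₀)) + 1) / R) +
    (B + R * Real.sqrt (2 / lam₀)) / R) * Real.sqrt (2 * (1 + |lam₁|))

theorem regretConst_pos (hB : 0 ≤ B) (hR : 0 < R) : 0 < regretConst B R lam₀ lam₁ := by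
  have h1 := expPosPart_pos (-(B + R * Real.sqrt (2 / lam₀)))
  rw [regretConst]
  positivity

/-- Regret bound on the event that the self-normalized noise is controlled. -/
theorem regret_le_of_noiseForm_le [MeasurableSpace X] [mΩ : MeasurableSpace Ω]
    {ℱ : Filtration ℕ mΩ} {T : ℕ} {f : X → ℝ} {ε : ℕ → Ω → ℝ} {x xrep : ℕ → Ω → X} {F : H}
    (hk : ∀ x z, k x z = inner ℝ (φ x) (φ z)) (hlam₀ : 0 < lam₀)
    (hlam : lam₀ ≤ lam) (hlam₁ : lam ≤ lam₁) (hk1 : ∀ z, k z z ≤ 1) (hR : 0 < R) (hB : 0 ≤ B)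
    (hδ : 0 < δ) (hδ1 : δ < 1) (hf : ∀ z, f z = inner ℝ (φ z) F) (hF : ‖F‖ ≤ B)
    (hrun : IsRun ℱ k lam δ f T ε x xrep) {w : Ω}
    (hQ : ∀ t ≤ T, noiseForm k lam (pts x t w) (noise ε t w) ≤
      2 * R ^ 2 * (infoGain k lam (pts x t w) + Real.log (1 / δ))) {n : ℕ} (hn : 1 ≤ n)
    (hnT : n ≤ T) :
    regret f xrep n w ≤ regretConst B R lam₀ lam₁ * (beta (X := X) k lam δ B R n *
      Real.sqrt (n * maxInfoGain k lam n)) := by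
  have : Nonempty X := ⟨x 0 w⟩
  have hlam' : 0 < lam := hlam₀.trans_le hlam
  have hlam₁' : 0 < lam₁ := hlam'.trans_le hlam₁
  set c := B + R * Real.sqrt (2 / lam₀) with hc
  have hc0 : 0 ≤ c := by positivity
  set γ := maxInfoGain k lam n with hγ
  have hγ0 : 0 ≤ γ := maxInfoGain_nonneg
  set s := Real.sqrt (2 * (1 + lam₁) * γ) with hs
  set ωmax := scale (X := X) k lam δ (n - 1) with hωmax
  have hsdiag : ∀ z, Real.sqrt (k z z) ≤ s := fun z =>
    Real.sqrt_le_sqrt (kernel_diag_le_maxInfoGain hk hlam' hk1 hlam₁ hn z)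
  have hdiag : ∀ z, Real.sqrt (k z z) = ‖φ z‖ := fun z => by
    rw [hk, real_inner_self_eq_norm_sq, Real.sqrt_sq (norm_nonneg _)]
  have hmain := sum_regret_le (f := f) (μ := fun t z => runMean k lam f x ε t w z)
    (σ := fun t z => postStd k lam (pts x t w) z)
    (m := fun t => incumbent k lam (pts x t w) (obs f x ε t w))
    (ω := fun t => scale (X := X) k lam δ t) (x := fun t => x t w) (xr := fun t => xrep t w)
    (c := c) (n := n) (B := B) (s := s) (ωmax := ωmax) hB hc0 (Real.sqrt_nonneg _) hn
    (fun t _ => zero_lt_one.trans_le (one_le_scale hδ hδ1 t))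
    (fun t ht => scale_mono hk hlam' hk1 (Nat.le_sub_one_of_lt ht))
    (fun t z => postStd_nonneg _ _)
    (fun t z => postStd_succ_le (pts x (t + 1) w) hk hlam' z)
    (fun t z => (Real.sqrt_le_sqrt (postVar_le hk hlam' _ z)).trans (hsdiag z))
    (fun z => by
      rw [hf, mul_comm]
      refine (abs_real_inner_le_norm _ _).trans ?_
      rw [← hdiag]
      exact mul_le_mul (hsdiag z) hF (norm_nonneg _) (Real.sqrt_nonneg _))
    (fun t ht z => abs_sub_runMean_le hk hlam₀ hlam hk1 hR.le hB hδ hδ1 hf hF x ε t w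
      (hQ t (ht.le.trans hnT)) z)
    rfl (fun z => by simp [runMean, postMean, dotProduct])
    (fun t i hi => postMean_le_incumbent (pts x t w) (obs f x ε t w) ⟨i, hi⟩)
    (fun t ht => by
      obtain ⟨i, hi⟩ := exists_incumbent_eq (k := k) (lam := lam) ht (pts x t w) (obs f x ε t w)
      exact ⟨i, i.2, hi⟩)
    (fun t ht z => hrun.isMax t (ht.trans_le hnT) w z)
    (fun t ht => hrun.report t (ht.trans_le hnT) w)
    (by
      rw [hs, Real.sq_sqrt (by positivity)]
      simp only [postStd_sq hk hlam']
      refine (sum_postVar_le hk hlam' hk1 hlam₁ x w n).trans ?_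
      gcongr
      exact infoGain_le_maxInfoGain hk hlam' hk1 _)
  rw [regret]
  refine hmain.trans ?_
  have hτ := expPosPart_pos (-c)
  have hω0 : 0 ≤ ωmax := Real.sqrt_nonneg _
  set β := beta (X := X) k lam δ B R n with hβ
  have hβeq : β = B + R * (Real.sqrt 2 * ωmax) := beta_eq n
  have h2 : 1 ≤ Real.sqrt 2 := by rw [Real.one_le_sqrt]; norm_num
  have hBβ : B ≤ β := by rw [hβeq]; linarith [show 0 ≤ R * (Real.sqrt 2 * ωmax) by positivity]
  -- Here `R > 0` is essential: it makes `β_n` dominate the exploration scale, at the cost of a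
  -- factor `1 / R` in the constant.
  have hωβ : ωmax ≤ β / R := by
    rw [le_div_iff₀ hR, hβeq]
    have : ωmax ≤ Real.sqrt 2 * ωmax := le_mul_of_one_le_left hω0 h2
    nlinarith
  have hβ0 : 0 ≤ β := hB.trans hBβ
  have hsqrt : Real.sqrt n * s = Real.sqrt (2 * (1 + |lam₁|)) * Real.sqrt (n * γ) := by
    rw [hs, abs_of_pos hlam₁', Real.sqrt_mul (by positivity), Real.sqrt_mul (Nat.cast_nonneg n)]
    ring
  rw [hsqrt, regretConst, ← hc]
  calc ((1 + c / expPosPart (-c)) * (B + (3 * c + 1) * ωmax) + c * ωmax) *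
        (Real.sqrt (2 * (1 + |lam₁|)) * Real.sqrt (n * γ))
      ≤ ((1 + c / expPosPart (-c)) * (β + (3 * c + 1) * (β / R)) + c * (β / R)) *
        (Real.sqrt (2 * (1 + |lam₁|)) * Real.sqrt (n * γ)) := by gcongr
    _ = _ := by ring

/-- Regret bound of the algorithm with high probability, for sub-Gaussian noise of positive
scale. -/
theorem measure_regret_le [MeasurableSpace X] [mΩ : MeasurableSpace Ω] {P : Measure Ω}
    [IsProbabilityMeasure P]
    {ℱ : Filtration ℕ mΩ} {T : ℕ} {f : X → ℝ} {ε : ℕ → Ω → ℝ} {x xrep : ℕ → Ω → X} {F : H}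
    (hk : ∀ x z, k x z = inner ℝ (φ x) (φ z)) (hkm : Measurable fun p : X × X => k p.1 p.2)
    (hlam₀ : 0 < lam₀)
    (hlam : lam₀ ≤ lam) (hlam₁ : lam ≤ lam₁) (hk1 : ∀ z, k z z ≤ 1) (hR : 0 < R) (hB : 0 ≤ B)
    (hδ : 0 < δ) (hδ1 : δ < 1) (hf : ∀ z, f z = inner ℝ (φ z) F) (hF : ‖F‖ ≤ B)
    (hε : CondSubGaussianNoise P ℱ R T ε) (hrun : IsRun ℱ k lam δ f T ε x xrep) :
    ENNReal.ofReal (1 - δ) ≤ P {w | ∀ n : ℕ, 1 ≤ n → n ≤ T →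
      regret f xrep n w ≤ regretConst B R lam₀ lam₁ * (beta (X := X) k lam δ B R n *
        Real.sqrt (n * maxInfoGain k lam n))} :=
  (measure_noiseForm_le hk (hlam₀.trans_le hlam) hR hkm hε hrun.predictable hδ).trans
    (measure_mono fun _ hw _ hn hnT => regret_le_of_noiseForm_le hk hlam₀ hlam hlam₁ hk1 hR hB
      hδ hδ1 hf hF hrun hw hn hnT)

theorem CondSubGaussianNoise.mono [mΩ : MeasurableSpace Ω] {P : Measure Ω} {ℱ : Filtration ℕ mΩ}
    {T : ℕ} {ε : ℕ → Ω → ℝ} {R' : ℝ} (hε : CondSubGaussianNoise P ℱ R T ε) (hR : 0 ≤ R)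
    (hRR' : R ≤ R') : CondSubGaussianNoise P ℱ R' T ε where
  adapted := hε.adapted
  integrable := hε.integrable
  condExp_le t ht s := by
    filter_upwards [hε.condExp_le t ht s] with w hw
    refine hw.trans (Real.exp_le_exp.mpr ?_)
    gcongr

/-- Where the information gain is bounded away from zero, the confidence width is at most a
multiple of its square root. -/
theorem beta_mul_sqrt_le [Nonempty X] (hk : ∀ x z, k x z = inner ℝ (φ x) (φ z)) (hlam : 0 < lam)
    (hk1 : ∀ z, k z z ≤ 1) (hB : 0 ≤ B) (hR : 0 ≤ R) (hδ : 0 < δ) (hδ1 : δ < 1) {g : ℝ}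
    (hg : 0 < g) {n : ℕ} (hgn : g ≤ maxInfoGain k lam n) :
    beta (X := X) k lam δ B R n * Real.sqrt (n * maxInfoGain k lam n) ≤
      (B / Real.sqrt g + R * Real.sqrt (2 * (1 + (1 + Real.log (1 / δ)) / g))) *
        (maxInfoGain k lam n * Real.sqrt n) := by
  set γ := maxInfoGain k lam n with hγ
  have hγ0 : 0 < γ := hg.trans_le hgn
  have hL : 0 ≤ Real.log (1 / δ) := Real.log_nonneg (by rw [le_div_iff₀ hδ]; linarith)
  have h1 : B ≤ B / Real.sqrt g * Real.sqrt γ := by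
    rw [div_mul_eq_mul_div, le_div_iff₀ (Real.sqrt_pos.mpr hg)]
    gcongr
  have h2 : Real.sqrt (2 * (maxInfoGain k lam (n - 1) + 1 + Real.log (1 / δ))) ≤
      Real.sqrt (2 * (1 + (1 + Real.log (1 / δ)) / g)) * Real.sqrt γ := by
    rw [← Real.sqrt_mul (by positivity)]
    refine Real.sqrt_le_sqrt ?_
    have h3 := maxInfoGain_mono hk hlam hk1 (Nat.sub_le n 1)
    have h4 : 1 + Real.log (1 / δ) ≤ (1 + Real.log (1 / δ)) / g * γ := by
      rw [div_mul_eq_mul_div, le_div_iff₀ hg]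
      gcongr
    rw [mul_assoc]
    refine mul_le_mul_of_nonneg_left ?_ zero_le_two
    rw [add_mul]
    linarith
  have h5 : beta (X := X) k lam δ B R n ≤
      (B / Real.sqrt g + R * Real.sqrt (2 * (1 + (1 + Real.log (1 / δ)) / g))) * Real.sqrt γ := by
    rw [beta, add_mul, mul_assoc]
    exact add_le_add h1 (mul_le_mul_of_nonneg_left h2 hR)
  have h6 : Real.sqrt γ * Real.sqrt (n * γ) = γ * Real.sqrt n := by
    rw [Real.sqrt_mul (Nat.cast_nonneg n), mul_comm (Real.sqrt n), ← mul_assoc,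
      Real.mul_self_sqrt hγ0.le]
  calc _ ≤ _ := mul_le_mul_of_nonneg_right h5 (Real.sqrt_nonneg _)
    _ = _ := by rw [mul_assoc, h6]

end Algorithm

/-! ### Feature map of the reproducing kernel Hilbert space -/

section ReproducingKernel

variable {H X : Type*} [NormedAddCommGroup H] [InnerProductSpace ℝ H] [CompleteSpace H]
  [RKHS ℝ H X ℝ]

theorem rkhsKernel_eq_inner (x z : X) :
    rkhsKernel H x z = inner ℝ (RKHS.kerFun H x (1 : ℝ)) (RKHS.kerFun H z (1 : ℝ)) := by
  rw [RKHS.kerFun_inner, RKHS.kerFun_apply, rkhsKernel]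
  simp

theorem apply_eq_inner_kerFun (f : H) (z : X) : f z = inner ℝ (RKHS.kerFun H z (1 : ℝ)) f := by
  rw [RKHS.kerFun_inner]
  simp

theorem apply_eq_zero_of_rkhsKernel_diag (f : H) {z : X} (hz : rkhsKernel H z z ≤ 0) :
    f z = 0 := by
  rw [rkhsKernel_eq_inner, real_inner_self_nonpos] at hz
  rw [apply_eq_inner_kerFun, hz, inner_zero_left]

end ReproducingKernel

end GPEI

/-! ### The regret theorem -/

theorem theorem1 (B R lam₀ lam₁ : ℝ) (hB : 0 ≤ B) (hR : 0 ≤ R) (hlam₀ : 0 < lam₀) :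
    -- `R_n = O(γ_n √n)`, with a constant that depends on `B`, `R`, `δ`, the range of `λ`, and `k`
    (∀ (d : ℕ) (X : Set (EuclideanSpace ℝ (Fin d)))
      (H : Type*) [NormedAddCommGroup H] [InnerProductSpace ℝ H] [CompleteSpace H] [RKHS ℝ H X ℝ],
      Measurable (fun p : X × X => GPEI.rkhsKernel H p.1 p.2) →
      (∀ z : X, GPEI.rkhsKernel H z z ≤ 1) →
      ∀ δ : ℝ, 0 < δ → δ < 1 →
      ∃ C : ℝ, 0 < C ∧
        ∀ lam : ℝ, lam₀ ≤ lam → lam ≤ lam₁ →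
        ∀ (T : ℕ) (Ω : Type*) [mΩ : MeasurableSpace Ω] (P : Measure Ω) [IsProbabilityMeasure P]
          (ℱ : Filtration ℕ mΩ) (f : H) (ε : ℕ → Ω → ℝ) (x xrep : ℕ → Ω → X),
          ‖f‖ ≤ B →
          GPEI.CondSubGaussianNoise P ℱ R T ε →
          GPEI.IsRun ℱ (GPEI.rkhsKernel H) lam δ (fun z => f z) T ε x xrep →
          ENNReal.ofReal (1 - δ) ≤ P {w | ∀ n : ℕ, 1 ≤ n → n ≤ T →
            GPEI.regret (fun z => f z) xrep n w ≤
              C * (GPEI.maxInfoGain (GPEI.rkhsKernel H) lam n * Real.sqrt n)}) ∧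
    -- `R_n = O(β_n √(n γ_n))`, with a constant that depends on `B`, `R` and the range of `λ` only
    (0 < R →
      ∃ C : ℝ, 0 < C ∧
        ∀ (d : ℕ) (X : Set (EuclideanSpace ℝ (Fin d)))
          (H : Type*) [NormedAddCommGroup H] [InnerProductSpace ℝ H] [CompleteSpace H]
          [RKHS ℝ H X ℝ],
        Measurable (fun p : X × X => GPEI.rkhsKernel H p.1 p.2) →
        (∀ z : X, GPEI.rkhsKernel H z z ≤ 1) →
        ∀ δ : ℝ, 0 < δ → δ < 1 →
        ∀ lam : ℝ, lam₀ ≤ lam → lam ≤ lam₁ →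
        ∀ (T : ℕ) (Ω : Type*) [mΩ : MeasurableSpace Ω] (P : Measure Ω) [IsProbabilityMeasure P]
          (ℱ : Filtration ℕ mΩ) (f : H) (ε : ℕ → Ω → ℝ) (x xrep : ℕ → Ω → X),
          ‖f‖ ≤ B →
          GPEI.CondSubGaussianNoise P ℱ R T ε →
          GPEI.IsRun ℱ (GPEI.rkhsKernel H) lam δ (fun z => f z) T ε x xrep →
          ENNReal.ofReal (1 - δ) ≤ P {w | ∀ n : ℕ, 1 ≤ n → n ≤ T →
            GPEI.regret (fun z => f z) xrep n w ≤
              C * (GPEI.beta (GPEI.rkhsKernel H) lam δ B R n *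
                Real.sqrt (n * GPEI.maxInfoGain (GPEI.rkhsKernel H) lam n))}) := by
  refine ⟨fun d X H _ _ _ _ hkm hk1 δ hδ hδ1 => ?_, fun hRpos => ⟨GPEI.regretConst B R lam₀ lam₁,
    GPEI.regretConst_pos hB hRpos, ?_⟩⟩
  -- Noise of scale `R` is also of scale `R + 1`, and the algorithm does not involve `R`, so the
  -- positive-scale bound covers `R = 0`.
  · have hR1 : 0 < R + 1 := by linarith
    by_cases hz : ∀ z : X, GPEI.rkhsKernel H z z ≤ 0
    · refine ⟨1, one_pos, fun lam _ _ T Ω _ P _ ℱ f ε x xrep _ _ _ => ?_⟩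
      have hf : ∀ z, f z = 0 := fun z => GPEI.apply_eq_zero_of_rkhsKernel_diag f (hz z)
      have huniv : {w | ∀ n : ℕ, 1 ≤ n → n ≤ T → GPEI.regret (fun z => f z) xrep n w ≤
          1 * (GPEI.maxInfoGain (GPEI.rkhsKernel H) lam n * Real.sqrt n)} = Set.univ := by
        refine Set.eq_univ_of_forall fun w n _ _ => ?_
        have h1 : GPEI.regret (fun z => f z) xrep n w = 0 := by simp [GPEI.regret, hf]
        rw [h1, one_mul]
        exact mul_nonneg GPEI.maxInfoGain_nonneg (Real.sqrt_nonneg _)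
      rw [huniv, measure_univ]
      exact ENNReal.ofReal_le_one.mpr (by linarith)
    · obtain ⟨z₀, hz₀⟩ := not_forall.mp hz
      have hk₀ := not_le.mp hz₀
      have : Nonempty X := ⟨z₀⟩
      -- A lower bound for every `γ_n` with `n ≥ 1`, uniform in `lam`. The absolute value makes `g`
      -- positive before any `lam` is given, when `lam₁ > 0` is not yet known.
      set g := GPEI.rkhsKernel H z₀ z₀ / (2 * (1 + |lam₁|)) with hg
      have hg0 : 0 < g := by positivity
      have hL : 0 ≤ Real.log (1 / δ) := Real.log_nonneg (by rw [le_div_iff₀ hδ]; linarith)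
      set D := B / Real.sqrt g + (R + 1) * Real.sqrt (2 * (1 + (1 + Real.log (1 / δ)) / g)) with hD
      have hD0 : 0 < D := by
        have : 0 < Real.sqrt (2 * (1 + (1 + Real.log (1 / δ)) / g)) :=
          Real.sqrt_pos.mpr (by positivity)
        positivity
      have hC0 := GPEI.regretConst_pos (lam₀ := lam₀) (lam₁ := lam₁) hB hR1
      refine ⟨GPEI.regretConst B (R + 1) lam₀ lam₁ * D, mul_pos hC0 hD0,
        fun lam hlam hlam₁ T Ω _ P _ ℱ f ε x xrep hf hε hrun => ?_⟩
      have hlam' : 0 < lam := hlam₀.trans_le hlam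
      refine (GPEI.measure_regret_le GPEI.rkhsKernel_eq_inner hkm hlam₀ hlam hlam₁ hk1 hR1 hB hδ
        hδ1 (GPEI.apply_eq_inner_kerFun f) hf (hε.mono hR (by linarith)) hrun).trans
        (measure_mono fun w hw n hn hnT => (hw n hn hnT).trans ?_)
      rw [mul_assoc]
      refine mul_le_mul_of_nonneg_left ?_ hC0.le
      refine GPEI.beta_mul_sqrt_le GPEI.rkhsKernel_eq_inner hlam' hk1 hB hR1.le hδ hδ1 hg0 ?_
      rw [hg, div_le_iff₀ (by positivity), mul_comm, abs_of_pos (hlam'.trans_le hlam₁)]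
      exact GPEI.kernel_diag_le_maxInfoGain GPEI.rkhsKernel_eq_inner hlam' hk1 hlam₁ hn z₀
  · intro d X H _ _ _ _ hkm hk1 δ hδ hδ1 lam hlam hlam₁ T Ω _ P _ ℱ f ε x xrep hf hε hrun
    exact GPEI.measure_regret_le GPEI.rkhsKernel_eq_inner hkm hlam₀ hlam hlam₁ hk1 hRpos hB hδ
      hδ1 (GPEI.apply_eq_inner_kerFun f) hf hε hrun
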